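/- \textbf{Theorem A.} Let $f$ be an orientation-preserving $C^2$ diffeomorphism of $[0,1]$ with no fixed point in $(0,1)$. For $n\ge 1$ let $\mathrm{var}(\log Df^n)$ be the total variation on $[0,1]$ of the logarithm of the derivative of the $n$-th iterate of $f$. Then the limit $$\mathrm{dist}_\infty(f)=\lim_{n\to\infty}\frac1n\,\mathrm{var}(\log Df^n)$$ (the asymptotic distortion of $f$) exists and is finite, and the following three conditions are equivalent: \begin{enumerate} \item $\mathrm{dist}_\infty(f)=0$; \item both endpoints are parabolic fixed points of $f$, i.e. $Df(0)=Df(1)=1$, and the Mather invariant of $f$ is trivial; \item $f$ is the time-$1$ map of the flow of a $C^1$ vector field on $[0,1]$ that is $C^1$-flat at $0$ and $1$, i.e. that vanishes together with its first derivative at $0$ and at $1$. \end{enumerate} Here the Mather invariant is defined as follows. Let $X$ (resp. $Y$) be the $C^1$ vector field on $[0,1)$ (resp. on $(0,1]$), extending continuously to $[0,1]$, such that $f$ restricted to $[0,1)$ (resp. $(0,1]$) is the time-$1$ map of its flow, and let $f_t$ (resp. $f^t$) denote this flow. For $a,b\in(0,1)$ put $\psi_X(t)=f_t(a)$, $\psi_Y(t)=f^t(b)$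 and $M_f^{a,b}=\psi_Y^{-1}\circ\psi_X:\mathbb R\to\mathbb R$. This map commutes with $t\mapsto t+1$, hence induces a diffeomorphism of the circle $\mathbb R/\mathbb Z$. The Mather invariant of $f$ is the class of this circle diffeomorphism modulo pre- and post-composition with rotations (it does not depend on $a,b$); it is trivial if it is the class of the rotations. -/

import Mathlib

open Set Filter Topology
open scoped ENNReal

/-- The closed unit interval, as a subset of `ℝ`. A map of `[0,1]` is represented by a function
`ℝ → ℝ`, of which only the values on `[0,1]` are ever used. -/
abbrev unitI : Set ℝ := Icc 0 1

/-- `f` is an orientation-preserving `C²` diffeomorphism of `[0,1]` without fixed points in the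
interior: the class `Diff₊^{2,Δ}([0,1])`. At the endpoints, derivatives are one-sided. -/
structure IsDiffTwoDelta (f : ℝ → ℝ) : Prop where
  mapsTo : MapsTo f unitI unitI
  strictMonoOn : StrictMonoOn f unitI
  contDiffOn : ContDiffOn ℝ 2 f unitI
  exists_inverse : ∃ g : ℝ → ℝ, MapsTo g unitI unitI ∧ ContDiffOn ℝ 2 g unitI ∧
    InvOn g f unitI unitI
  no_fixed_point : ∀ x ∈ Ioo (0 : ℝ) 1, f x ≠ x

/-- `var (log Dg)`, the total variation on `[0,1]` of the logarithm of the derivative of `g`. -/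
noncomputable def varLogDeriv (g : ℝ → ℝ) : ℝ≥0∞ :=
  eVariationOn (fun x => Real.log (derivWithin g unitI x)) unitI

/-- The sequence `var (log Dfⁿ) / n`. -/
noncomputable def distortionSeq (f : ℝ → ℝ) (n : ℕ) : ℝ≥0∞ :=
  varLogDeriv (f^[n]) / (n : ℝ≥0∞)

/-- The asymptotic distortion `dist_∞(f) = lim var (log Dfⁿ) / n`. -/
noncomputable def asymptoticDistortion (f : ℝ → ℝ) : ℝ≥0∞ :=
  limUnder atTop (distortionSeq f)

/-- Both endpoints are parabolic fixed points of the diffeomorphism `f` of `[0,1]` (which fixes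
them): the derivative of `f` equals `1` there. -/
def ParabolicEndpoints (f : ℝ → ℝ) : Prop :=
  derivWithin f unitI 0 = 1 ∧ derivWithin f unitI 1 = 1

/-- `φ` (written `φ t x`) is the complete flow, on the interval `J`, of the vector field `X`
(identified with its coefficient function): for each `x ∈ J`, the curve `t ↦ φ t x` is a solution
in `J`, defined for all real times, of `u' = X(u)`, `u(0) = x`. -/
structure IsFlowOn (J : Set ℝ) (X : ℝ → ℝ) (φ : ℝ → ℝ → ℝ) : Prop where
  mapsTo : ∀ t : ℝ, MapsTo (φ t) J J
  zero : ∀ x ∈ J, φ 0 x = x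
  hasDerivAt : ∀ x ∈ J, ∀ t : ℝ, HasDerivAt (fun s => φ s x) (X (φ t x)) t

/-- `X` is a `C¹` vector field on the interval `J` with flow `φ`, and `f` is the time-`1` map of
this flow. -/
structure Generates (J : Set ℝ) (X : ℝ → ℝ) (φ : ℝ → ℝ → ℝ) (f : ℝ → ℝ) : Prop where
  contDiffOn : ContDiffOn ℝ 1 X J
  isFlowOn : IsFlowOn J X φ
  time_one : ∀ x ∈ J, φ 1 x = f x

/-- `X` is the left generating (Szekeres) vector field of `f`, with flow `φ` on `[0,1)`: it is `C¹`
on `[0,1)`, it extends continuously to `[0,1]`, and `f` is the time-`1` map of its flow. -/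
def IsLeftSzekeres (f X : ℝ → ℝ) (φ : ℝ → ℝ → ℝ) : Prop :=
  Generates (Ico 0 1) X φ f ∧ ∃ l : ℝ, Tendsto X (𝓝[<] 1) (𝓝 l)

/-- `Y` is the right generating (Szekeres) vector field of `f`, with flow `χ` on `(0,1]`: it is `C¹`
on `(0,1]`, it extends continuously to `[0,1]`, and `f` is the time-`1` map of its flow. -/
def IsRightSzekeres (f Y : ℝ → ℝ) (χ : ℝ → ℝ → ℝ) : Prop :=
  Generates (Ioc 0 1) Y χ f ∧ ∃ l : ℝ, Tendsto Y (𝓝[>] 0) (𝓝 l)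

/-- `M` is the map `M_f^{a,b} = ψ_Y⁻¹ ∘ ψ_X : ℝ → ℝ`, where `ψ_X(t) = f_t(a)` and `ψ_Y(t) = f^t(b)`
are the parametrizations of `(0,1)` by the flows `f_t`, `f^t` of the left and right generating
vector fields `X`, `Y` of `f`. (It commutes with `t ↦ t + 1`, so it is a lift of a circle
diffeomorphism.) -/
def IsMatherMap (f : ℝ → ℝ) (a b : ℝ) (M : ℝ → ℝ) : Prop :=
  ∃ (X Y : ℝ → ℝ) (φ χ : ℝ → ℝ → ℝ), IsLeftSzekeres f X φ ∧ IsRightSzekeres f Y χ ∧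
    ∀ t : ℝ, χ (M t) b = φ t a

/-- The Mather invariant `M_f`: the class of the maps `M_f^{a,b}`, `a, b ∈ (0,1)`, modulo pre- and
post-composition with rotations of the circle `ℝ/ℤ`. A circle diffeomorphism is represented by
all its lifts to `ℝ`, and the rotations by the translations of `ℝ`. -/
def matherInvariant (f : ℝ → ℝ) : Set (ℝ → ℝ) :=
  {N | ∃ a ∈ Ioo (0 : ℝ) 1, ∃ b ∈ Ioo (0 : ℝ) 1, ∃ M : ℝ → ℝ, IsMatherMap f a b M ∧
    ∃ c d : ℝ, N = fun t => M (t + c) + d}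

/-- The class of the rotations of the circle, represented by their lifts. -/
def rotationClass : Set (ℝ → ℝ) :=
  {N | ∃ c : ℝ, N = fun t => t + c}

/-- The Mather invariant of `f` is trivial: it is the class of the rotations. -/
def TrivialMatherInvariant (f : ℝ → ℝ) : Prop :=
  matherInvariant f = rotationClass

/-- `f` is the time-`1` map of the flow of a `C¹` vector field on `[0,1]` which is `C¹`-flat at
both endpoints (it vanishes there together with its first derivative). -/
def IsTimeOneOfFlatField (f : ℝ → ℝ) : Prop :=
  ∃ (X : ℝ → ℝ) (φ : ℝ → ℝ → ℝ), Generates unitI X φ f ∧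
    (X 0 = 0 ∧ derivWithin X unitI 0 = 0) ∧ (X 1 = 0 ∧ derivWithin X unitI 1 = 0)

/-!
Write `ℓ = log Df`, a Lipschitz function on `[0,1]`, and `g = f⁻¹`. The chain rule gives
`log Dfⁿ = ∑_{k<n} ℓ ∘ fᵏ`, a Birkhoff sum, so `var (log Dfⁿ)` is subadditive and bounded by a
multiple of `n`; Fekete's lemma yields the finite limit. Everything is symmetric under `f ↔ g`, so
points may be supposed to move towards `0`.

*Vanishing distortion gives a flat field.* The iterates of a compact subinterval of `(0,1)` have
summable lengths, hence `log Dfⁿ(x) - log Dfⁿ(1/2)` converges to a `C¹` function `asympLogD f` of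
`x ∈ (0,1)`, and likewise for `g`. If `f y ≤ x ≤ y`, the intervals `gᵖ[x, y]`, `p < n`, do not overlap,
and the increment of `log Dfⁿ` along `gᵖ[x, y]` is the increment of `log Dfⁿ⁻ᵖ` minus that of
`log Dgᵖ` along `[x, y]`. Averaging over `p`, a vanishing distortion forces the increments of
`asympLogD f` and `asympLogD g` along `[x, y]` to be equal (`IsDiffTwoDelta.asympLogD_sub_eq`). For
`x = f y` this reads `Df(0) = Df(1)`; as `0` attracts and `1` repels, both are `1`. The field
`X = -τ exp (-asympLogD f)` is then `f`-invariant, and its time coordinate `∫ dx / X` conjugates `f`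
to the translation by `1` for a suitable `τ`. Since `X` is comparable to `f - id`, the forward series
for `DX / X` bounds `DX` near `0`, and the backward one, which has the same sum, bounds it near `1`:
`X` is `C¹`-flat at both ends.

*A flat field gives vanishing distortion.* Here `log Dfⁿ = log |X ∘ fⁿ| - log |X|`. In the time
coordinate the derivative of `log |X|` is `DX`, which tends to `0` at both ends, so the variation of
`log |X|` over a time interval of length `O(n)` is `o(n)`. What remains are two intervals at the
ends, whose first `n` iterates stay small; there the Lipschitz continuity of `ℓ` suffices
(`Generates.asymptoticDistortion_eq_zero`).

*The Mather invariant.* If some Mather map is a translation, differentiating `χ (M t) b = φ t a`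
shows that the two generating fields coincide in `(0,1)`; they glue to a `C¹` field on `[0,1]`, whose
derivative at an endpoint is `log Df` there. Conversely a flat field is both a left and a right
generating field. It is the only one (`Generates.field_unique`), since any two are asymptotic to
`f - id` at the endpoint and their ratio is `f`-invariant; so every Mather map is a translation.
-/

/-! ### Total variation of `log Dfⁿ` and the existence of the limit -/

theorem eVariationOn_add_le {α : Type*} [LinearOrder α] (u v : α → ℝ) (s : Set α) :
    eVariationOn (fun x => u x + v x) s ≤ eVariationOn u s + eVariationOn v s := by
  refine iSup_le ?_
  rintro ⟨n, w, hw, hs⟩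
  refine le_trans ?_ (add_le_add (eVariationOn.sum_le (n := n) hw hs)
    (eVariationOn.sum_le (n := n) hw hs))
  rw [← Finset.sum_add_distrib]
  exact Finset.sum_le_sum fun i _ => edist_add_add_le _ _ _ _

theorem eVariationOn_neg {α : Type*} [LinearOrder α] (u : α → ℝ) (s : Set α) :
    eVariationOn (fun x => -u x) s = eVariationOn u s := by
  simp [eVariationOn, edist_neg_neg]

theorem LipschitzOnWith.eVariationOn_Icc_le {u : ℝ → ℝ} {C : NNReal} {a b : ℝ}
    (h : LipschitzOnWith C u (Icc a b)) : eVariationOn u (Icc a b) ≤ ENNReal.ofReal (C * (b - a)) := by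
  have h1 := h.comp_eVariationOn_le (g := id) (s := Icc a b) (mapsTo_id _)
  rcases lt_or_ge b a with hab | hab
  · simp [Icc_eq_empty_of_lt hab]
  refine h1.trans ?_
  have h2 := (monotone_id (α := ℝ)).monotoneOn (Icc a b) |>.eVariationOn_eq (left_mem_Icc.2 hab)
    (right_mem_Icc.2 hab)
  rw [inter_self] at h2
  rw [ENNReal.ofReal_mul C.coe_nonneg, ENNReal.ofReal_coe_nnreal]
  gcongr
  exact h2.le

/-- The logarithm `log Df` of the derivative of a map of `[0,1]`. -/
noncomputable def logD (f : ℝ → ℝ) (x : ℝ) : ℝ := Real.log (derivWithin f unitI x)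

theorem unitI_mem_nhds {x : ℝ} (hx : x ∈ Ioo (0 : ℝ) 1) : unitI ∈ 𝓝 x := Icc_mem_nhds hx.1 hx.2

theorem Ioo_subset_unitI : Ioo (0 : ℝ) 1 ⊆ unitI := Ioo_subset_Icc_self

theorem uniqueDiffOn_unitI : UniqueDiffOn ℝ unitI := uniqueDiffOn_Icc zero_lt_one

theorem zero_mem_unitI : (0 : ℝ) ∈ unitI := by simp
theorem one_mem_unitI : (1 : ℝ) ∈ unitI := by simp

theorem mem_Ioo_of_ne {x : ℝ} (hx : x ∈ unitI) (h0 : x ≠ 0) (h1 : x ≠ 1) : x ∈ Ioo (0 : ℝ) 1 :=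
  ⟨lt_of_le_of_ne hx.1 h0.symm, lt_of_le_of_ne hx.2 h1⟩

namespace IsDiffTwoDelta

variable {f g : ℝ → ℝ}

theorem map_zero (hf : IsDiffTwoDelta f) : f 0 = 0 := by
  obtain ⟨g, hg, -, -, hr⟩ := hf.exists_inverse
  have h := hf.strictMonoOn.monotoneOn zero_mem_unitI (hg zero_mem_unitI) (hg zero_mem_unitI).1
  rw [hr zero_mem_unitI] at h
  exact le_antisymm h (hf.mapsTo zero_mem_unitI).1

theorem map_one (hf : IsDiffTwoDelta f) : f 1 = 1 := by
  obtain ⟨g, hg, -, -, hr⟩ := hf.exists_inverse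
  have h := hf.strictMonoOn.monotoneOn (hg one_mem_unitI) one_mem_unitI (hg one_mem_unitI).2
  rw [hr one_mem_unitI] at h
  exact le_antisymm (hf.mapsTo one_mem_unitI).2 h

theorem mapsTo_Ioo (hf : IsDiffTwoDelta f) : MapsTo f (Ioo 0 1) (Ioo 0 1) := fun _ hx =>
  ⟨hf.map_zero ▸ hf.strictMonoOn zero_mem_unitI (Ioo_subset_unitI hx) hx.1,
    hf.map_one ▸ hf.strictMonoOn (Ioo_subset_unitI hx) one_mem_unitI hx.2⟩

theorem iterate_mem (hf : IsDiffTwoDelta f) {x : ℝ} (hx : x ∈ unitI) (n : ℕ) : f^[n] x ∈ unitI :=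
  hf.mapsTo.iterate n hx

theorem iterate_mem_Ioo (hf : IsDiffTwoDelta f) {x : ℝ} (hx : x ∈ Ioo (0 : ℝ) 1) (n : ℕ) :
    f^[n] x ∈ Ioo (0 : ℝ) 1 :=
  hf.mapsTo_Ioo.iterate n hx

theorem iterate_zero (hf : IsDiffTwoDelta f) (n : ℕ) : f^[n] 0 = 0 :=
  Function.iterate_fixed hf.map_zero n

theorem iterate_one (hf : IsDiffTwoDelta f) (n : ℕ) : f^[n] 1 = 1 :=
  Function.iterate_fixed hf.map_one n

theorem iterate_strictMonoOn (hf : IsDiffTwoDelta f) (n : ℕ) : StrictMonoOn (f^[n]) unitI := by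
  induction n with
  | zero => exact strictMonoOn_id
  | succ n ih =>
    intro x hx y hy h
    rw [Function.iterate_succ_apply', Function.iterate_succ_apply']
    exact hf.strictMonoOn (hf.iterate_mem hx n) (hf.iterate_mem hy n) (ih hx hy h)

/-- The inverse of a diffeomorphism of the class is again in the class. -/
theorem exists_symm (hf : IsDiffTwoDelta f) : ∃ g, IsDiffTwoDelta g ∧ InvOn g f unitI unitI := by
  obtain ⟨g, hg, hgc, hl, hr⟩ := hf.exists_inverse
  refine ⟨g, ⟨hg, ?_, hgc, ⟨f, hf.mapsTo, hf.contDiffOn, hr, hl⟩, ?_⟩, hl, hr⟩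
  · intro x hx y hy h
    by_contra! h'
    have := hf.strictMonoOn.monotoneOn (hg hy) (hg hx) h'
    rw [hr hx, hr hy] at this
    exact absurd h (not_lt.2 this)
  · intro x hx h
    apply hf.no_fixed_point x hx
    conv_lhs => rw [← h]
    exact hr (Ioo_subset_unitI hx)

theorem hasDerivWithinAt (hf : IsDiffTwoDelta f) {x : ℝ} (hx : x ∈ unitI) :
    HasDerivWithinAt f (derivWithin f unitI x) unitI x :=
  ((hf.contDiffOn.differentiableOn (by norm_num)) x hx).hasDerivWithinAt

theorem hasDerivAt' (hf : IsDiffTwoDelta f) {x : ℝ} (hx : x ∈ Ioo (0 : ℝ) 1) :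
    HasDerivAt f (derivWithin f unitI x) x :=
  (hf.hasDerivWithinAt (Ioo_subset_unitI hx)).hasDerivAt (unitI_mem_nhds hx)

theorem derivWithin_mul_symm (hf : IsDiffTwoDelta f) (hg : IsDiffTwoDelta g)
    (hi : InvOn g f unitI unitI) {x : ℝ} (hx : x ∈ unitI) :
    derivWithin g unitI (f x) * derivWithin f unitI x = 1 := by
  have h := (hg.hasDerivWithinAt (hf.mapsTo hx)).comp x (hf.hasDerivWithinAt hx) hf.mapsTo
  have h2 : HasDerivWithinAt (g ∘ f) 1 unitI x :=
    (hasDerivWithinAt_id x unitI).congr (fun y hy => hi.1 hy) (hi.1 hx)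
  exact (uniqueDiffOn_unitI x hx).eq_deriv _ h h2

theorem derivWithin_pos (hf : IsDiffTwoDelta f) {x : ℝ} (hx : x ∈ unitI) :
    0 < derivWithin f unitI x := by
  obtain ⟨g, hg, hi⟩ := hf.exists_symm
  have h := hf.derivWithin_mul_symm hg hi hx
  have h0 : 0 ≤ derivWithin f unitI x := hf.strictMonoOn.monotoneOn.derivWithin_nonneg
  refine lt_of_le_of_ne h0 fun h' => ?_
  rw [← h', mul_zero] at h
  exact zero_ne_one h

theorem exp_logD (hf : IsDiffTwoDelta f) {x : ℝ} (hx : x ∈ unitI) :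
    Real.exp (logD f x) = derivWithin f unitI x := Real.exp_log (hf.derivWithin_pos hx)

theorem hasDerivAt (hf : IsDiffTwoDelta f) {x : ℝ} (hx : x ∈ Ioo (0 : ℝ) 1) :
    HasDerivAt f (Real.exp (logD f x)) x := by
  rw [hf.exp_logD (Ioo_subset_unitI hx)]
  exact hf.hasDerivAt' hx

theorem logD_symm (hf : IsDiffTwoDelta f) (hg : IsDiffTwoDelta g)
    (hi : InvOn g f unitI unitI) {x : ℝ} (hx : x ∈ unitI) : logD g (f x) = - logD f x := by
  have h := hf.derivWithin_mul_symm hg hi hx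
  rw [eq_neg_iff_add_eq_zero, logD, logD,
    ← Real.log_mul (hg.derivWithin_pos (hf.mapsTo hx)).ne' (hf.derivWithin_pos hx).ne', h,
    Real.log_one]

theorem contDiffOn_logD (hf : IsDiffTwoDelta f) : ContDiffOn ℝ 1 (logD f) unitI :=
  (hf.contDiffOn.derivWithin (m := 1) uniqueDiffOn_unitI (by norm_num)).log
    fun _ hx => (hf.derivWithin_pos hx).ne'

theorem continuousOn_logD (hf : IsDiffTwoDelta f) : ContinuousOn (logD f) unitI :=
  hf.contDiffOn_logD.continuousOn

theorem continuousOn (hf : IsDiffTwoDelta f) : ContinuousOn f unitI :=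
  hf.contDiffOn.continuousOn

theorem exists_lipschitz_logD (hf : IsDiffTwoDelta f) :
    ∃ C : NNReal, LipschitzOnWith C (logD f) unitI :=
  hf.contDiffOn_logD.exists_lipschitzOnWith (by norm_num) (convex_Icc 0 1) isCompact_Icc

theorem hasDerivAt_logD (hf : IsDiffTwoDelta f) {x : ℝ} (hx : x ∈ Ioo (0 : ℝ) 1) :
    HasDerivAt (logD f) (derivWithin (logD f) unitI x) x :=
  ((hf.contDiffOn_logD.differentiableOn (by norm_num)) x
    (Ioo_subset_unitI hx)).hasDerivWithinAt.hasDerivAt (unitI_mem_nhds hx)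

theorem continuousOn_deriv_logD (hf : IsDiffTwoDelta f) :
    ContinuousOn (derivWithin (logD f) unitI) unitI :=
  hf.contDiffOn_logD.continuousOn_derivWithin uniqueDiffOn_unitI le_rfl

/-- The chain rule: `D(fⁿ) = exp (∑_{k<n} log Df ∘ fᵏ)`. -/
theorem hasDerivWithinAt_iterate (hf : IsDiffTwoDelta f) (n : ℕ) {x : ℝ} (hx : x ∈ unitI) :
    HasDerivWithinAt (f^[n]) (Real.exp (birkhoffSum f (logD f) n x)) unitI x := by
  induction n with
  | zero => simpa using hasDerivWithinAt_id x unitI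
  | succ n ih =>
    have h := hf.hasDerivWithinAt (hf.iterate_mem hx n)
    have h' := h.comp x ih (hf.mapsTo.iterate n)
    rw [birkhoffSum_succ, Real.exp_add, mul_comm, hf.exp_logD (hf.iterate_mem hx n),
      Function.iterate_succ']
    exact h'

theorem hasDerivAt_iterate (hf : IsDiffTwoDelta f) (n : ℕ) {x : ℝ} (hx : x ∈ Ioo (0 : ℝ) 1) :
    HasDerivAt (f^[n]) (Real.exp (birkhoffSum f (logD f) n x)) x :=
  (hf.hasDerivWithinAt_iterate n (Ioo_subset_unitI hx)).hasDerivAt (unitI_mem_nhds hx)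

theorem varLogDeriv_iterate (hf : IsDiffTwoDelta f) (n : ℕ) :
    varLogDeriv (f^[n]) = eVariationOn (birkhoffSum f (logD f) n) unitI := by
  refine eVariationOn.congr fun x hx => ?_
  rw [(hf.hasDerivWithinAt_iterate n hx).derivWithin (uniqueDiffOn_unitI x hx), Real.log_exp]

theorem eVariationOn_birkhoffSum_le (hf : IsDiffTwoDelta f) {C : NNReal}
    (hC : LipschitzOnWith C (logD f) unitI) (n : ℕ) {a b : ℝ} (ha : 0 ≤ a) (hab : a ≤ b)
    (hb : b ≤ 1) : eVariationOn (birkhoffSum f (logD f) n) (Icc a b) ≤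
      ∑ k ∈ Finset.range n, ENNReal.ofReal (C * (f^[k] b - f^[k] a)) := by
  have hsub : Icc a b ⊆ unitI := Icc_subset_Icc ha hb
  induction n with
  | zero =>
    rw [eVariationOn.constant_on]
    · simp
    · rintro _ ⟨x, -, rfl⟩ _ ⟨y, -, rfl⟩
      simp
  | succ n ih =>
    have e : birkhoffSum f (logD f) (n + 1) =
      fun x => birkhoffSum f (logD f) n x + (logD f ∘ f^[n]) x :=
      funext fun x => birkhoffSum_succ _ _ _ _
    rw [e, Finset.sum_range_succ]
    refine (eVariationOn_add_le _ _ _).trans (add_le_add ih ?_)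
    have hm := (hf.iterate_strictMonoOn n).monotoneOn
    have ha' : a ∈ unitI := hsub (left_mem_Icc.2 hab)
    have hb' : b ∈ unitI := hsub (right_mem_Icc.2 hab)
    refine (eVariationOn.comp_le_of_monotoneOn (s := Icc (f^[n] a) (f^[n] b)) _ _ (hm.mono hsub)
      fun x hx => ⟨hm ha' (hsub hx) hx.1, hm (hsub hx) hb' hx.2⟩).trans ?_
    refine LipschitzOnWith.eVariationOn_Icc_le (hC.mono (Icc_subset_Icc ?_ ?_))
    exacts [(hf.iterate_mem ha' n).1, (hf.iterate_mem hb' n).2]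

/-- The limit of `var (log Dfⁿ) / n` exists and is finite, by subadditivity. -/
theorem exists_tendsto_distortionSeq (hf : IsDiffTwoDelta f) :
    ∃ d : ℝ, Tendsto (distortionSeq f) atTop (𝓝 (ENNReal.ofReal d)) := by
  obtain ⟨C, hC⟩ := hf.exists_lipschitz_logD
  set v : ℕ → ℝ≥0∞ := fun n => eVariationOn (birkhoffSum f (logD f) n) unitI with hv
  have hfin : ∀ n, v n ≠ ⊤ := fun n =>
    ne_top_of_le_ne_top (ENNReal.sum_ne_top.2 fun _ _ => ENNReal.ofReal_ne_top)
      (hf.eVariationOn_birkhoffSum_le hC n le_rfl zero_le_one le_rfl)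
  have hsub : ∀ m n, v (m + n) ≤ v m + v n := by
    intro m n
    have e : birkhoffSum f (logD f) (m + n) =
      fun x => birkhoffSum f (logD f) m x + (birkhoffSum f (logD f) n ∘ f^[m]) x :=
      funext fun x => birkhoffSum_add _ _ _ _ _
    simp only [hv, e]
    refine (eVariationOn_add_le _ _ _).trans (add_le_add le_rfl ?_)
    exact eVariationOn.comp_le_of_monotoneOn _ _ (hf.iterate_strictMonoOn m).monotoneOn
      (hf.mapsTo.iterate m)
  have hs : Subadditive fun n => (v n).toReal := by
    intro m n
    rw [← ENNReal.toReal_add (hfin m) (hfin n)]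
    exact ENNReal.toReal_mono (by simp [hfin]) (hsub m n)
  have hb : BddBelow (range fun n : ℕ => (v n).toReal / n) :=
    ⟨0, by rintro _ ⟨n, rfl⟩; positivity⟩
  refine ⟨hs.lim, ((ENNReal.continuous_ofReal.tendsto _).comp (hs.tendsto_lim hb)).congr' ?_⟩
  filter_upwards [eventually_gt_atTop 0] with n hn
  rw [Function.comp_apply, ENNReal.ofReal_div_of_pos (by exact_mod_cast hn),
    ENNReal.ofReal_toReal (hfin n), ENNReal.ofReal_natCast, distortionSeq, hf.varLogDeriv_iterate]

theorem tendsto_asymptoticDistortion (hf : IsDiffTwoDelta f) :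
    Tendsto (distortionSeq f) atTop (𝓝 (asymptoticDistortion f)) := by
  obtain ⟨d, hd⟩ := hf.exists_tendsto_distortionSeq
  exact tendsto_nhds_limUnder ⟨_, hd⟩

theorem asymptoticDistortion_ne_top (hf : IsDiffTwoDelta f) : asymptoticDistortion f ≠ ⊤ := by
  obtain ⟨d, hd⟩ := hf.exists_tendsto_distortionSeq
  rw [tendsto_nhds_unique hf.tendsto_asymptoticDistortion hd]
  exact ENNReal.ofReal_ne_top

theorem asymptoticDistortion_eq_zero_iff (hf : IsDiffTwoDelta f) :
    asymptoticDistortion f = 0 ↔ Tendsto (distortionSeq f) atTop (𝓝 0) :=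
  ⟨fun h => h ▸ hf.tendsto_asymptoticDistortion,
    fun h => tendsto_nhds_unique hf.tendsto_asymptoticDistortion h⟩

theorem symm_comp_iterate (hf : IsDiffTwoDelta f) (hi : InvOn g f unitI unitI) (n : ℕ) {x : ℝ}
    (hx : x ∈ unitI) : g^[n] (f^[n] x) = x := by
  induction n generalizing x with
  | zero => rfl
  | succ n ih =>
    rw [Function.iterate_succ_apply g, Function.iterate_succ_apply' f, hi.1 (hf.iterate_mem hx n),
      ih hx]

theorem birkhoffSum_symm (hf : IsDiffTwoDelta f) (hg : IsDiffTwoDelta g)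
    (hi : InvOn g f unitI unitI) (n : ℕ) {x : ℝ} (hx : x ∈ unitI) :
    birkhoffSum g (logD g) n (f^[n] x) = - birkhoffSum f (logD f) n x := by
  induction n generalizing x with
  | zero => simp
  | succ n ih =>
    rw [birkhoffSum_succ, Function.iterate_succ_apply, ih (hf.mapsTo hx),
      hf.symm_comp_iterate hi n (hf.mapsTo hx), hf.logD_symm hg hi hx, birkhoffSum_succ']
    ring

/-- A diffeomorphism and its inverse have the same distortion. -/
theorem distortionSeq_symm_le (hf : IsDiffTwoDelta f) (hg : IsDiffTwoDelta g)
    (hi : InvOn g f unitI unitI) (n : ℕ) : distortionSeq f n ≤ distortionSeq g n := by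
  rw [distortionSeq, distortionSeq, hf.varLogDeriv_iterate, hg.varLogDeriv_iterate]
  refine ENNReal.div_le_div_right ?_ _
  have : eVariationOn (birkhoffSum f (logD f) n) unitI =
      eVariationOn ((fun y => - birkhoffSum g (logD g) n y) ∘ f^[n]) unitI :=
    eVariationOn.congr fun x hx => by
      simp [hf.birkhoffSum_symm hg hi n hx]
  rw [this]
  refine (eVariationOn.comp_le_of_monotoneOn _ _ (hf.iterate_strictMonoOn n).monotoneOn
      (hf.mapsTo.iterate n)).trans (eVariationOn_neg _ _).le

theorem asymptoticDistortion_symm (hf : IsDiffTwoDelta f) (hg : IsDiffTwoDelta g)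
    (hi : InvOn g f unitI unitI) : asymptoticDistortion g = asymptoticDistortion f := by
  have : distortionSeq g = distortionSeq f := funext fun n =>
    le_antisymm (hg.distortionSeq_symm_le hf hi.symm n) (hf.distortionSeq_symm_le hg hi n)
  rw [asymptoticDistortion, asymptoticDistortion, this]

end IsDiffTwoDelta

/-! ### Orbits of a diffeomorphism without interior fixed point -/

/-- The map `f` of `[0,1]` moves every interior point towards the endpoint `e ∈ {0, 1}`. -/
def MovesTo (f : ℝ → ℝ) (e : ℝ) : Prop :=
  (e = 0 ∧ ∀ x ∈ Ioo (0 : ℝ) 1, f x < x) ∨ (e = 1 ∧ ∀ x ∈ Ioo (0 : ℝ) 1, x < f x)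

/-- A telescoping estimate for a sequence in `[0,1]` and its translate by `m`. -/
theorem abs_sum_shift_sub_le {a : ℕ → ℝ} (ha : ∀ k, a k ∈ unitI) (m n : ℕ) :
    |∑ k ∈ Finset.range n, (a (k + m) - a k)| ≤ m := by
  have h : ∑ k ∈ Finset.range n, (a (k + m) - a k) =
      ∑ j ∈ Finset.range m, (a (n + j) - a j) := by
    rw [Finset.sum_sub_distrib, Finset.sum_sub_distrib, sub_eq_sub_iff_add_eq_add, add_comm]
    have h1 := Finset.sum_range_add a n m
    have h2 := Finset.sum_range_add a m n
    rw [add_comm m n] at h2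
    simp only [add_comm _ m]
    linarith
  rw [h]
  refine (Finset.abs_sum_le_sum_abs _ _).trans ?_
  refine (Finset.sum_le_sum fun j _ => (?_ : |a (n + j) - a j| ≤ 1)).trans (by simp)
  have h1 := ha (n + j)
  have h2 := ha j
  rw [abs_le]
  constructor <;> linarith [h1.1, h1.2, h2.1, h2.2]

namespace IsDiffTwoDelta

variable {f g : ℝ → ℝ} {e : ℝ}

theorem exists_movesTo (hf : IsDiffTwoDelta f) : MovesTo f 0 ∨ MovesTo f 1 := by
  by_contra! h
  simp only [MovesTo, not_or, not_and, not_forall, not_lt, true_and] at h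
  obtain ⟨⟨⟨x, hx, hx'⟩, -⟩, -, y, hy, hy'⟩ := h
  obtain ⟨z, hz, hz'⟩ := isPreconnected_Ioo.intermediate_value₂ hy hx
    (hf.continuousOn.mono Ioo_subset_unitI) continuousOn_id hy' hx'
  exact hf.no_fixed_point z hz hz'

theorem movesTo_symm (hg : IsDiffTwoDelta g)
    (hi : InvOn g f unitI unitI) (h : MovesTo f 0) : MovesTo g 1 := by
  refine Or.inr ⟨rfl, fun x hx => ?_⟩
  have h' := (h.resolve_right (by simp)).2 (g x) (hg.mapsTo_Ioo hx)
  rwa [hi.2 (Ioo_subset_unitI hx)] at h'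

theorem movesTo_symm' (hg : IsDiffTwoDelta g)
    (hi : InvOn g f unitI unitI) (h : MovesTo f 1) : MovesTo g 0 := by
  refine Or.inl ⟨rfl, fun x hx => ?_⟩
  have h' := (h.resolve_left (by simp)).2 (g x) (hg.mapsTo_Ioo hx)
  rwa [hi.2 (Ioo_subset_unitI hx)] at h'

theorem _root_.MovesTo.mem (h : MovesTo f e) : e ∈ unitI := by
  rcases h with ⟨rfl, -⟩ | ⟨rfl, -⟩ <;> simp

theorem _root_.MovesTo.map_eq (h : MovesTo f e) (hf : IsDiffTwoDelta f) : f e = e := by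
  rcases h with ⟨rfl, -⟩ | ⟨rfl, -⟩
  exacts [hf.map_zero, hf.map_one]

theorem tendsto_iterate (hf : IsDiffTwoDelta f) (h : MovesTo f e) {x : ℝ}
    (hx : x ∈ Ioo (0 : ℝ) 1) : Tendsto (fun n => f^[n] x) atTop (𝓝 e) := by
  -- The orbit is monotone; its limit in `[0,1]` is a fixed point, hence an endpoint.
  have key : ∀ l : ℝ, Tendsto (fun n => f^[n] x) atTop (𝓝 l) → l ∈ unitI ∧ f l = l := by
    intro l hl
    have hlI : l ∈ unitI := isClosed_Icc.mem_of_tendsto hl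
      (Eventually.of_forall fun n => hf.iterate_mem (Ioo_subset_unitI hx) n)
    refine ⟨hlI, ?_⟩
    have h1 : Tendsto (fun n => f (f^[n] x)) atTop (𝓝 (f l)) :=
      (hf.continuousOn l hlI).tendsto.comp (tendsto_nhdsWithin_iff.2 ⟨hl,
        Eventually.of_forall fun n => hf.iterate_mem (Ioo_subset_unitI hx) n⟩)
    have h2 : Tendsto (fun n => f (f^[n] x)) atTop (𝓝 l) := by
      simpa only [Function.iterate_succ_apply'] using (tendsto_add_atTop_iff_nat 1).2 hl
    exact tendsto_nhds_unique h1 h2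
  rcases h with ⟨rfl, h⟩ | ⟨rfl, h⟩
  · have ha : Antitone fun n => f^[n] x := antitone_nat_of_succ_le fun n => by
      rw [Function.iterate_succ_apply']
      exact (h _ (hf.iterate_mem_Ioo hx n)).le
    have hb : BddBelow (range fun n => f^[n] x) :=
      ⟨0, by rintro _ ⟨n, rfl⟩; exact (hf.iterate_mem_Ioo hx n).1.le⟩
    have ht := tendsto_atTop_ciInf ha hb
    obtain ⟨hlI, hl⟩ := key _ ht
    convert ht using 2
    by_contra h0
    refine hf.no_fixed_point _ (mem_Ioo_of_ne hlI (Ne.symm h0) fun h1 => ?_) hl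
    have h2 : (⨅ n, f^[n] x) ≤ f^[0] x := ciInf_le hb 0
    rw [h1] at h2
    exact absurd hx.2 (not_lt.2 h2)
  · have ha : Monotone fun n => f^[n] x := monotone_nat_of_le_succ fun n => by
      rw [Function.iterate_succ_apply']
      exact (h _ (hf.iterate_mem_Ioo hx n)).le
    have hb : BddAbove (range fun n => f^[n] x) :=
      ⟨1, by rintro _ ⟨n, rfl⟩; exact (hf.iterate_mem_Ioo hx n).2.le⟩
    have ht := tendsto_atTop_ciSup ha hb
    obtain ⟨hlI, hl⟩ := key _ ht
    convert ht using 2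
    by_contra h0
    refine hf.no_fixed_point _ (mem_Ioo_of_ne hlI (fun h1 => ?_) (Ne.symm h0)) hl
    have h2 : f^[0] x ≤ (⨆ n, f^[n] x) := le_ciSup hb 0
    rw [h1] at h2
    exact absurd hx.1 (not_lt.2 h2)

/-- The orbit of `x` stays between `x` and the endpoint towards which points move. -/
theorem sum_abs_iterate_sub_le (hf : IsDiffTwoDelta f) (h : MovesTo f e) {x : ℝ}
    (hx : x ∈ Ioo (0 : ℝ) 1) (n : ℕ) :
    ∑ k ∈ Finset.range n, |f^[k] (f x) - f^[k] x| ≤ |x - e| := by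
  have hn := hf.iterate_mem_Ioo hx n
  rcases h with ⟨rfl, h⟩ | ⟨rfl, h⟩
  · have : ∀ k ∈ Finset.range n, |f^[k] (f x) - f^[k] x| = -(f^[k + 1] x - f^[k] x) := by
      intro k _
      rw [← Function.iterate_succ_apply, Function.iterate_succ_apply']
      exact abs_of_nonpos (sub_nonpos.2 (h _ (hf.iterate_mem_Ioo hx k)).le)
    rw [Finset.sum_congr rfl this, Finset.sum_neg_distrib,
      Finset.sum_range_sub (fun k => f^[k] x), sub_zero, abs_of_pos hx.1, Function.iterate_zero_apply]
    linarith [hn.1]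
  · have : ∀ k ∈ Finset.range n, |f^[k] (f x) - f^[k] x| = f^[k + 1] x - f^[k] x := by
      intro k _
      rw [← Function.iterate_succ_apply, Function.iterate_succ_apply']
      exact abs_of_nonneg (sub_nonneg.2 (h _ (hf.iterate_mem_Ioo hx k)).le)
    rw [Finset.sum_congr rfl this, Finset.sum_range_sub (fun k => f^[k] x), abs_sub_comm,
      abs_of_pos (sub_pos.2 hx.2), Function.iterate_zero_apply]
    linarith [hn.2]

theorem sum_abs_iterate_sub_le_one (hf : IsDiffTwoDelta f) {x y : ℝ} (hx : x ∈ Ioo (0 : ℝ) 1)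
    (hy : y ∈ uIcc x (f x)) (n : ℕ) :
    ∑ k ∈ Finset.range n, |f^[k] y - f^[k] x| ≤ 1 := by
  obtain ⟨e, h⟩ : ∃ e, MovesTo f e := hf.exists_movesTo.elim (fun h => ⟨_, h⟩) fun h => ⟨_, h⟩
  have hsub : uIcc x (f x) ⊆ unitI :=
    uIcc_subset_Icc (Ioo_subset_unitI hx) (hf.mapsTo (Ioo_subset_unitI hx))
  refine le_trans (Finset.sum_le_sum fun k _ => ?_)
    ((hf.sum_abs_iterate_sub_le h hx n).trans ?_)
  · exact abs_sub_left_of_mem_uIcc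
      (((hf.iterate_strictMonoOn k).monotoneOn.mono hsub).mapsTo_uIcc hy)
  · have := h.mem
    rw [abs_le]
    constructor <;> linarith [this.1, this.2, hx.1, hx.2]

/-- The iterates of a compact subinterval of `(0,1)` have summable lengths. -/
theorem summable_iterate_sub (hf : IsDiffTwoDelta f) {a b : ℝ} (ha : a ∈ Ioo (0 : ℝ) 1)
    (hb : b ∈ Ioo (0 : ℝ) 1) (hab : a ≤ b) : Summable fun k => f^[k] b - f^[k] a := by
  have ha' := Ioo_subset_unitI ha
  have hb' := Ioo_subset_unitI hb
  have hmono := fun k => (hf.iterate_strictMonoOn k).monotoneOn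
  have hpos : ∀ k, 0 ≤ f^[k] b - f^[k] a := fun k => sub_nonneg.2 (hmono k ha' hb' hab)
  rcases hf.exists_movesTo with h | h
  · obtain ⟨m, hm⟩ := ((hf.tendsto_iterate h hb).eventually (gt_mem_nhds ha.1)).exists
    refine summable_of_sum_range_le (c := m) hpos fun n => ?_
    refine le_trans ?_ ((neg_le_abs _).trans
      (abs_sum_shift_sub_le (a := fun k => f^[k] b) (fun k => hf.iterate_mem hb' k) m n))
    rw [← Finset.sum_neg_distrib]
    refine Finset.sum_le_sum fun k _ => ?_
    have := hmono k (hf.iterate_mem hb' m) ha' hm.le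
    rw [← Function.iterate_add_apply] at this
    linarith
  · obtain ⟨m, hm⟩ := ((hf.tendsto_iterate h ha).eventually (lt_mem_nhds hb.2)).exists
    refine summable_of_sum_range_le (c := m) hpos fun n => ?_
    refine le_trans ?_ ((le_abs_self _).trans
      (abs_sum_shift_sub_le (a := fun k => f^[k] a) (fun k => hf.iterate_mem ha' k) m n))
    refine Finset.sum_le_sum fun k _ => ?_
    have := hmono k hb' (hf.iterate_mem ha' m) hm.le
    rw [← Function.iterate_add_apply] at this
    linarith

end IsDiffTwoDelta

/-! ### The asymptotic logarithmic derivative -/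

/-- The limit `lim_n (log Dfⁿ(x) - log Dfⁿ(1/2))`, written as a series. The base point `1/2` is an
arbitrary normalization. -/
noncomputable def asympLogD (f : ℝ → ℝ) (x : ℝ) : ℝ :=
  ∑' k, (logD f (f^[k] x) - logD f (f^[k] (1 / 2)))

/-- The termwise derivative of the series `asympLogD f`. -/
noncomputable def asympLogDDeriv (f : ℝ → ℝ) (x : ℝ) : ℝ :=
  ∑' k, derivWithin (logD f) unitI (f^[k] x) * Real.exp (birkhoffSum f (logD f) k x)

theorem half_mem_Ioo : (1 / 2 : ℝ) ∈ Ioo (0 : ℝ) 1 := by norm_num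

namespace IsDiffTwoDelta

variable {f g : ℝ → ℝ} {e : ℝ}

theorem abs_birkhoffSum_sub_le {C : NNReal} (hf : IsDiffTwoDelta f)
    (hC : LipschitzOnWith C (logD f) unitI) {x y : ℝ} (hx : x ∈ unitI) (hy : y ∈ unitI) (n : ℕ) :
    |birkhoffSum f (logD f) n x - birkhoffSum f (logD f) n y| ≤
      C * ∑ k ∈ Finset.range n, |f^[k] x - f^[k] y| := by
  rw [birkhoffSum, birkhoffSum, ← Finset.sum_sub_distrib, Finset.mul_sum]
  refine (Finset.abs_sum_le_sum_abs _ _).trans (Finset.sum_le_sum fun k _ => ?_)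
  exact hC.dist_le_mul _ (hf.iterate_mem hx k) _ (hf.iterate_mem hy k)

theorem summable_abs_iterate_sub (hf : IsDiffTwoDelta f) {x y : ℝ} (hx : x ∈ Ioo (0 : ℝ) 1)
    (hy : y ∈ Ioo (0 : ℝ) 1) : Summable fun k => |f^[k] x - f^[k] y| := by
  rcases le_total x y with h | h
  · simpa only [abs_sub_comm] using (hf.summable_iterate_sub hx hy h).abs
  · exact (hf.summable_iterate_sub hy hx h).abs

theorem summable_logD_sub (hf : IsDiffTwoDelta f) {x y : ℝ} (hx : x ∈ Ioo (0 : ℝ) 1)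
    (hy : y ∈ Ioo (0 : ℝ) 1) : Summable fun k => logD f (f^[k] x) - logD f (f^[k] y) := by
  obtain ⟨C, hC⟩ := hf.exists_lipschitz_logD
  refine Summable.of_norm_bounded ((hf.summable_abs_iterate_sub hx hy).mul_left (C : ℝ)) fun k => ?_
  exact hC.dist_le_mul _ (hf.iterate_mem (Ioo_subset_unitI hx) k) _
    (hf.iterate_mem (Ioo_subset_unitI hy) k)

theorem tendsto_birkhoffSum_sub (hf : IsDiffTwoDelta f) {x y : ℝ} (hx : x ∈ Ioo (0 : ℝ) 1)
    (hy : y ∈ Ioo (0 : ℝ) 1) :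
    Tendsto (fun n => birkhoffSum f (logD f) n x - birkhoffSum f (logD f) n y) atTop
      (𝓝 (asympLogD f x - asympLogD f y)) := by
  have key : ∀ {z : ℝ}, z ∈ Ioo (0 : ℝ) 1 →
      Tendsto (fun n => birkhoffSum f (logD f) n z - birkhoffSum f (logD f) n (1 / 2)) atTop
        (𝓝 (asympLogD f z)) := fun hz => by
    simp only [birkhoffSum, ← Finset.sum_sub_distrib]
    exact (hf.summable_logD_sub hz half_mem_Ioo).hasSum.tendsto_sum_nat
  simpa only [sub_sub_sub_cancel_right] using (key hx).sub (key hy)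

/-- Bounded distortion along a fundamental domain. -/
theorem abs_asympLogD_sub_le {C : NNReal} (hf : IsDiffTwoDelta f)
    (hC : LipschitzOnWith C (logD f) unitI) {x y : ℝ} (hx : x ∈ Ioo (0 : ℝ) 1)
    (hy : y ∈ uIcc x (f x)) : |asympLogD f y - asympLogD f x| ≤ C := by
  have hy' : y ∈ Ioo (0 : ℝ) 1 := ordConnected_Ioo.uIcc_subset hx (hf.mapsTo_Ioo hx) hy
  refine le_of_tendsto (hf.tendsto_birkhoffSum_sub hy' hx).abs (Eventually.of_forall fun n => ?_)
  refine (hf.abs_birkhoffSum_sub_le hC (Ioo_subset_unitI hy') (Ioo_subset_unitI hx) n).trans ?_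
  exact mul_le_of_le_one_right C.2 (hf.sum_abs_iterate_sub_le_one hx hy n)

theorem asympLogD_map_sub (hf : IsDiffTwoDelta f) (h : MovesTo f e) {x : ℝ}
    (hx : x ∈ Ioo (0 : ℝ) 1) : asympLogD f (f x) - asympLogD f x = logD f e - logD f x := by
  refine tendsto_nhds_unique (hf.tendsto_birkhoffSum_sub (hf.mapsTo_Ioo hx) hx) ?_
  have h1 : ∀ n, birkhoffSum f (logD f) n (f x) - birkhoffSum f (logD f) n x =
      logD f (f^[n] x) - logD f x := fun n => by
    have h1 := birkhoffSum_succ f (logD f) n x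
    rw [birkhoffSum_succ'] at h1
    linarith
  simp only [h1]
  refine Tendsto.sub_const ?_ _
  exact (hf.continuousOn_logD e h.mem).tendsto.comp (tendsto_nhdsWithin_iff.2
    ⟨hf.tendsto_iterate h hx,
      Eventually.of_forall fun n => hf.iterate_mem (Ioo_subset_unitI hx) n⟩)

/-- The derivatives `Dfᵏ` are summable, uniformly on compact subintervals of `(0,1)`: up to bounded
distortion, `Dfᵏ` is the ratio of the lengths of the `k`-th image and of the interval. -/
theorem exists_summable_bound_deriv (hf : IsDiffTwoDelta f) {a b : ℝ} (ha : a ∈ Ioo (0 : ℝ) 1)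
    (hb : b ∈ Ioo (0 : ℝ) 1) (hab : a < b) : ∃ u : ℕ → ℝ, Summable u ∧
      ∀ k, ∀ x ∈ Ioo a b, Real.exp (birkhoffSum f (logD f) k x) ≤ u k := by
  obtain ⟨C, hC⟩ := hf.exists_lipschitz_logD
  have hs := hf.summable_iterate_sub ha hb hab.le
  have hsub : Icc a b ⊆ Ioo 0 1 := Icc_subset_Ioo ha.1 hb.2
  have hsub' : Icc a b ⊆ unitI := hsub.trans Ioo_subset_unitI
  have haI := Ioo_subset_unitI ha
  have hbI := Ioo_subset_unitI hb
  have hmono := fun k => (hf.iterate_strictMonoOn k).monotoneOn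
  have hpos : ∀ k, 0 ≤ f^[k] b - f^[k] a := fun k => sub_nonneg.2 (hmono k haI hbI hab.le)
  set D : ℝ := C * ∑' k, (f^[k] b - f^[k] a)
  have hdist : ∀ k, ∀ x ∈ Icc a b, ∀ y ∈ Icc a b,
      birkhoffSum f (logD f) k x - birkhoffSum f (logD f) k y ≤ D := by
    intro k x hx y hy
    refine (le_abs_self _).trans
      ((hf.abs_birkhoffSum_sub_le hC (hsub' hx) (hsub' hy) k).trans ?_)
    refine mul_le_mul_of_nonneg_left ?_ C.2
    refine le_trans (Finset.sum_le_sum fun j _ => ?_) (hs.sum_le_tsum _ fun j _ => hpos j)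
    have h1 := hmono j haI (hsub' hx) hx.1
    have h2 := hmono j (hsub' hx) hbI hx.2
    have h3 := hmono j haI (hsub' hy) hy.1
    have h4 := hmono j (hsub' hy) hbI hy.2
    rw [abs_le]
    constructor <;> linarith
  refine ⟨fun k => Real.exp D / (b - a) * (f^[k] b - f^[k] a), hs.mul_left _, fun k x hx => ?_⟩
  obtain ⟨c, hc, hc'⟩ := exists_hasDerivAt_eq_slope (f^[k])
    (fun y => Real.exp (birkhoffSum f (logD f) k y)) hab
    (fun y hy => (hf.hasDerivAt_iterate k (hsub hy)).continuousAt.continuousWithinAt)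
    (fun y hy => hf.hasDerivAt_iterate k (hsub (Ioo_subset_Icc_self hy)))
  have h1 := hdist k x (Ioo_subset_Icc_self hx) c (Ioo_subset_Icc_self hc)
  beta_reduce
  rw [div_mul_eq_mul_div, mul_div_assoc, ← hc', ← Real.exp_add]
  exact Real.exp_le_exp.2 (by linarith)

theorem continuousOn_iterate (hf : IsDiffTwoDelta f) (k : ℕ) : ContinuousOn (f^[k]) unitI :=
  fun _ hx => (hf.hasDerivWithinAt_iterate k hx).continuousWithinAt

theorem continuousOn_birkhoffSum (hf : IsDiffTwoDelta f) (k : ℕ) :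
    ContinuousOn (birkhoffSum f (logD f) k) unitI :=
  continuousOn_finsetSum _ fun i _ =>
    hf.continuousOn_logD.comp (hf.continuousOn_iterate i) (hf.mapsTo.iterate i)

theorem exists_abs_deriv_logD_le (hf : IsDiffTwoDelta f) :
    ∃ B : ℝ, 0 ≤ B ∧ ∀ x ∈ unitI, |derivWithin (logD f) unitI x| ≤ B := by
  obtain ⟨B, hB⟩ := isCompact_Icc.exists_bound_of_continuousOn hf.continuousOn_deriv_logD
  exact ⟨B, (norm_nonneg _).trans (hB 0 zero_mem_unitI), hB⟩

theorem hasDerivAt_asympLogD (hf : IsDiffTwoDelta f) {x : ℝ} (hx : x ∈ Ioo (0 : ℝ) 1) :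
    HasDerivAt (asympLogD f) (asympLogDDeriv f x) x ∧ ContinuousAt (asympLogDDeriv f) x := by
  obtain ⟨a, ha0, hax⟩ := exists_between hx.1
  obtain ⟨b, hxb, hb1⟩ := exists_between hx.2
  have hx' : x ∈ Ioo a b := ⟨hax, hxb⟩
  have hsub : Ioo a b ⊆ Ioo 0 1 := Ioo_subset_Ioo ha0.le hb1.le
  obtain ⟨u, hu, hub⟩ := hf.exists_summable_bound_deriv ⟨ha0, (hax.trans hxb).trans hb1⟩
    ⟨(ha0.trans hax).trans hxb, hb1⟩ (hax.trans hxb)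
  obtain ⟨B, hB0, hB⟩ := hf.exists_abs_deriv_logD_le
  have hbound : ∀ k, ∀ y ∈ Ioo a b, ‖derivWithin (logD f) unitI (f^[k] y) *
      Real.exp (birkhoffSum f (logD f) k y)‖ ≤ B * u k := fun k y hy => by
    rw [norm_mul, Real.norm_eq_abs, Real.norm_eq_abs, Real.abs_exp]
    exact mul_le_mul (hB _ (hf.iterate_mem (Ioo_subset_unitI (hsub hy)) k)) (hub k y hy)
      (Real.exp_pos _).le hB0
  constructor
  · refine hasDerivAt_tsum_of_isPreconnected (hu.mul_left B) isOpen_Ioo isPreconnected_Ioo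
      (fun k y hy => ?_) hbound hx' (hf.summable_logD_sub hx half_mem_Ioo) hx'
    have hy' := hsub hy
    exact ((hf.hasDerivAt_logD (hf.iterate_mem_Ioo hy' k)).comp y
      (hf.hasDerivAt_iterate k hy')).sub_const _
  · refine ContinuousOn.continuousAt (s := Ioo a b) ?_ (isOpen_Ioo.mem_nhds hx')
    refine continuousOn_tsum (fun k => ?_) (hu.mul_left B) hbound
    have hsub' := hsub.trans Ioo_subset_unitI
    exact ((hf.continuousOn_deriv_logD.comp (hf.continuousOn_iterate k)
      (hf.mapsTo.iterate k)).mono hsub').mul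
      ((hf.continuousOn_birkhoffSum k).mono hsub').rexp

/-- If `X` is an `f`-invariant field controlled by the displacement `f - id`, the terms of the series
`asympLogDDeriv f x * X x` are controlled by the lengths of the intervals between consecutive points
of the orbit of `x`, which add up to the distance from `x` to the endpoint `e`. For `X` a multiple of
`exp (-asympLogD f)`, the product is `-DX`. -/
theorem exists_abs_deriv_mul_le (hf : IsDiffTwoDelta f) (h : MovesTo f e) {X : ℝ → ℝ} {K : ℝ}
    (hX : ∀ x ∈ Ioo (0 : ℝ) 1, X (f x) = Real.exp (logD f x) * X x)
    (hK : ∀ x ∈ Ioo (0 : ℝ) 1, |X x| ≤ K * |f x - x|) :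
    ∃ A : ℝ, ∀ x ∈ Ioo (0 : ℝ) 1, |asympLogDDeriv f x * X x| ≤ A * |x - e| := by
  obtain ⟨B, hB0, hB⟩ := hf.exists_abs_deriv_logD_le
  have hK0 : 0 ≤ K := by
    have h1 := (abs_nonneg _).trans (hK _ half_mem_Ioo)
    exact nonneg_of_mul_nonneg_left h1
      (abs_pos.2 (sub_ne_zero.2 (hf.no_fixed_point _ half_mem_Ioo)))
  refine ⟨B * K, fun x hx => ?_⟩
  have hXk : ∀ k, X (f^[k] x) = Real.exp (birkhoffSum f (logD f) k x) * X x := by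
    intro k
    induction k with
    | zero => simp
    | succ k ih =>
      rw [Function.iterate_succ_apply', hX _ (hf.iterate_mem_Ioo hx k), ih, birkhoffSum_succ,
        Real.exp_add]
      ring
  rw [asympLogDDeriv, ← tsum_mul_right, ← Real.norm_eq_abs]
  have hle : ∀ k, ‖derivWithin (logD f) unitI (f^[k] x) *
      Real.exp (birkhoffSum f (logD f) k x) * X x‖ ≤ B * K * |f^[k] (f x) - f^[k] x| := by
    intro k
    rw [mul_assoc, ← hXk, norm_mul, mul_assoc, Real.norm_eq_abs, Real.norm_eq_abs,
      ← Function.iterate_succ_apply, Function.iterate_succ_apply']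
    exact mul_le_mul (hB _ (hf.iterate_mem (Ioo_subset_unitI hx) k))
      (hK _ (hf.iterate_mem_Ioo hx k)) (abs_nonneg _) hB0
  have hsum := (hf.summable_abs_iterate_sub (hf.mapsTo_Ioo hx) hx)
  refine (tsum_of_norm_bounded (hsum.mul_left (B * K)).hasSum hle).trans ?_
  rw [tsum_mul_left]
  refine mul_le_mul_of_nonneg_left ?_ (mul_nonneg hB0 hK0)
  exact Real.tsum_le_of_sum_range_le (fun _ => abs_nonneg _)
    fun n => hf.sum_abs_iterate_sub_le h hx n

end IsDiffTwoDelta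

/-! ### Vanishing distortion: forward and backward asymptotics agree -/

namespace IsDiffTwoDelta

variable {f g : ℝ → ℝ} {e : ℝ}

theorem birkhoffSum_symm_iterate (hf : IsDiffTwoDelta f) (hg : IsDiffTwoDelta g)
    (hi : InvOn g f unitI unitI) {p n : ℕ} (hpn : p ≤ n) {x : ℝ} (hx : x ∈ unitI) :
    birkhoffSum f (logD f) n (g^[p] x) =
      birkhoffSum f (logD f) (n - p) x - birkhoffSum g (logD g) p x := by
  obtain ⟨m, rfl⟩ := Nat.exists_eq_add_of_le hpn
  rw [birkhoffSum_add, hg.birkhoffSum_symm hf hi.symm p hx, hg.symm_comp_iterate hi.symm p hx,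
    Nat.add_sub_cancel_left]
  ring

/-- The images under `g⁰, …, gⁿ⁻¹` of a subinterval `[x, y]` of a fundamental domain do not overlap,
so that the increments of `log Dfⁿ` along them add up to at most its total variation. -/
theorem ofReal_sum_le_varLogDeriv (hf : IsDiffTwoDelta f) (hg : IsDiffTwoDelta g)
    (hi : InvOn g f unitI unitI) (h : MovesTo f 0) {x y : ℝ} (hy : y ∈ Ioo (0 : ℝ) 1)
    (hxy : x ∈ Icc (f y) y) (n : ℕ) :
    ENNReal.ofReal (∑ p ∈ Finset.range n,
      |(birkhoffSum f (logD f) (n - p) y - birkhoffSum f (logD f) (n - p) x) -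
        (birkhoffSum g (logD g) p y - birkhoffSum g (logD g) p x)|) ≤ varLogDeriv (f^[n]) := by
  have hx : x ∈ Ioo (0 : ℝ) 1 := ⟨(hf.mapsTo_Ioo hy).1.trans_le hxy.1, hxy.2.trans_lt hy.2⟩
  have hxI := Ioo_subset_unitI hx
  have hyI := Ioo_subset_unitI hy
  have hyg : y ≤ g x := by
    have := hg.strictMonoOn.monotoneOn (hf.mapsTo hyI) hxI hxy.1
    rwa [hi.1 hyI] at this
  have hmono : Monotone fun p => g^[p] x := monotone_nat_of_le_succ fun p => by
    rw [Function.iterate_succ_apply']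
    exact (((hg.movesTo_symm hi h).resolve_left (by simp)).2 _ (hg.iterate_mem_Ioo hx p)).le
  rw [hf.varLogDeriv_iterate, ENNReal.ofReal_sum_of_nonneg fun _ _ => abs_nonneg _]
  have hsub : Icc (g^[0] x) (g^[n] x) ⊆ unitI :=
    Icc_subset_Icc hxI.1 (hg.iterate_mem hxI n).2
  refine le_trans ?_ (eVariationOn.mono _ hsub)
  rw [← eVariationOn.sum' _ hmono]
  refine Finset.sum_le_sum fun p hp => ?_
  have hpn := (Finset.mem_range.1 hp).le
  have hm := (hg.iterate_strictMonoOn p).monotoneOn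
  have h1 : g^[p] y ∈ Icc (g^[p] x) (g^[p + 1] x) :=
    ⟨hm hxI hyI hxy.2, by
      rw [Function.iterate_succ_apply]; exact hm hyI (hg.mapsTo hxI) hyg⟩
  have h2 : g^[p] x ∈ Icc (g^[p] x) (g^[p + 1] x) := ⟨le_rfl, hmono p.le_succ⟩
  refine le_trans (le_of_eq ?_) (eVariationOn.edist_le _ h1 h2)
  rw [hf.birkhoffSum_symm_iterate hg hi hpn hxI, hf.birkhoffSum_symm_iterate hg hi hpn hyI,
    edist_dist, Real.dist_eq]
  congr 2
  ring

/-- If the asymptotic distortion vanishes, then the forward and the backward asymptotic increments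
of the logarithm of the derivative coincide along a fundamental domain. -/
theorem asympLogD_sub_eq (hf : IsDiffTwoDelta f) (hg : IsDiffTwoDelta g)
    (hi : InvOn g f unitI unitI) (h : MovesTo f 0) (hd : asymptoticDistortion f = 0)
    {x y : ℝ} (hy : y ∈ Ioo (0 : ℝ) 1) (hxy : x ∈ Icc (f y) y) :
    asympLogD f y - asympLogD f x = asympLogD g y - asympLogD g x := by
  have hx : x ∈ Ioo (0 : ℝ) 1 := ⟨(hf.mapsTo_Ioo hy).1.trans_le hxy.1, hxy.2.trans_lt hy.2⟩
  have ha := hf.tendsto_birkhoffSum_sub hy hx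
  have hb := hg.tendsto_birkhoffSum_sub hy hx
  set α := asympLogD f y - asympLogD f x
  set β := asympLogD g y - asympLogD g x
  set a : ℕ → ℝ := fun n => birkhoffSum f (logD f) n y - birkhoffSum f (logD f) n x
  set b : ℕ → ℝ := fun n => birkhoffSum g (logD g) n y - birkhoffSum g (logD g) n x
  have ha' : Tendsto (fun n => |a (n + 1) - α|) atTop (𝓝 0) := by
    simpa using ((ha.comp (tendsto_add_atTop_nat 1)).sub_const α).abs
  have hb' : Tendsto (fun n => |b n - β|) atTop (𝓝 0) := by
    simpa using (hb.sub_const β).abs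
  have hc : Tendsto (fun n : ℕ => (n : ℝ)⁻¹ * ∑ q ∈ Finset.range n,
      (|a (q + 1) - α| + |b q - β|)) atTop (𝓝 0) := by
    simpa using (ha'.add hb').cesaro
  have hlim : Tendsto (fun n : ℕ => distortionSeq f n + ENNReal.ofReal ((n : ℝ)⁻¹ *
      ∑ q ∈ Finset.range n, (|a (q + 1) - α| + |b q - β|))) atTop (𝓝 0) := by
    have h2 := (ENNReal.continuous_ofReal.tendsto _).comp hc
    rw [ENNReal.ofReal_zero] at h2
    simpa using (hf.asymptoticDistortion_eq_zero_iff.1 hd).add h2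
  have hle : ENNReal.ofReal |α - β| ≤ 0 := by
    refine ge_of_tendsto hlim ?_
    filter_upwards [eventually_gt_atTop 0] with n hn
    have hn' : (0 : ℝ) < n := by exact_mod_cast hn
    have h1 := hf.ofReal_sum_le_varLogDeriv hg hi h hy hxy n
    have h2 : ENNReal.ofReal ((n : ℝ)⁻¹ * ∑ p ∈ Finset.range n, |a (n - p) - b p|) ≤
        distortionSeq f n := by
      rw [inv_mul_eq_div, ENNReal.ofReal_div_of_pos hn', ENNReal.ofReal_natCast]
      exact ENNReal.div_le_div_right h1 _
    refine le_trans ?_ (add_le_add_left h2 _)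
    rw [← ENNReal.ofReal_add (by positivity) (by positivity), ← mul_add]
    refine ENNReal.ofReal_le_ofReal ?_
    rw [le_inv_mul_iff₀ hn']
    have h3 : ∑ q ∈ Finset.range n, |a (q + 1) - α| =
        ∑ p ∈ Finset.range n, |a (n - p) - α| := by
      rw [← Finset.sum_range_reflect]
      refine Finset.sum_congr rfl fun p hp => ?_
      have := Finset.mem_range.1 hp
      rw [show n - 1 - p + 1 = n - p by omega]
    rw [Finset.sum_add_distrib, h3, ← Finset.sum_add_distrib, ← Finset.sum_add_distrib,
      ← nsmul_eq_mul, ← Finset.card_range n, ← Finset.sum_const, Finset.card_range]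
    refine Finset.sum_le_sum fun p _ => ?_
    have e1 := abs_sub_le α (a (n - p)) β
    have e2 := abs_sub_le (a (n - p)) (b p) β
    rw [abs_sub_comm α (a (n - p))] at e1
    linarith
  have h0 : |α - β| ≤ 0 := ENNReal.ofReal_eq_zero.1 (le_antisymm hle bot_le)
  exact sub_eq_zero.1 (abs_eq_zero.1 (le_antisymm h0 (abs_nonneg _)))

/-- The derivative at an attracting endpoint is at most `1`. -/
theorem logD_nonpos (hf : IsDiffTwoDelta f) (h : MovesTo f e) : logD f e ≤ 0 := by
  refine Real.log_nonpos (hf.derivWithin_pos h.mem).le ?_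
  have h1 := hasDerivWithinAt_iff_tendsto_slope.1 (hf.hasDerivWithinAt h.mem)
  have hsub : Ioo (0 : ℝ) 1 ⊆ unitI \ {e} := fun x hx => ⟨Ioo_subset_unitI hx, by
    rcases h with ⟨rfl, -⟩ | ⟨rfl, -⟩
    exacts [hx.1.ne', hx.2.ne]⟩
  have hne : (𝓝[unitI \ {e}] e).NeBot := by
    rw [← mem_closure_iff_nhdsWithin_neBot]
    refine closure_mono hsub ?_
    rw [closure_Ioo zero_ne_one]
    exact h.mem
  refine le_of_tendsto h1 ?_
  have hfe := h.map_eq hf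
  filter_upwards [self_mem_nhdsWithin] with y hy
  rw [slope_def_field, hfe]
  rcases h with ⟨rfl, h⟩ | ⟨rfl, h⟩
  · rcases eq_or_ne y 1 with rfl | hy1
    · simp [hf.map_one]
    have hy' := mem_Ioo_of_ne hy.1 hy.2 hy1
    rw [div_le_one (by linarith [hy'.1])]
    linarith [h y hy']
  · rcases eq_or_ne y 0 with rfl | hy0
    · simp [hf.map_zero]
    have hy' := mem_Ioo_of_ne hy.1 hy0 hy.2
    rw [div_le_one_of_neg (by linarith [hy'.2])]
    linarith [h y hy']

theorem logD_endpoints_eq_zero (hf : IsDiffTwoDelta f) (hg : IsDiffTwoDelta g)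
    (hi : InvOn g f unitI unitI) (h : MovesTo f 0) (hd : asymptoticDistortion f = 0) :
    logD f 0 = 0 ∧ logD f 1 = 0 := by
  have hm := half_mem_Ioo
  have hh := hg.movesTo_symm hi h
  have hfm := hf.mapsTo_Ioo hm
  have h1 := hf.asympLogD_sub_eq hg hi h hd (x := f (1 / 2)) hm
    ⟨le_rfl, ((h.resolve_right (by simp)).2 _ hm).le⟩
  have h2 := hf.asympLogD_map_sub h hm
  have h3 := hg.asympLogD_map_sub hh hfm
  have h4 := hf.logD_symm hg hi (Ioo_subset_unitI hm)
  have h5 := hf.logD_symm hg hi one_mem_unitI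
  rw [hf.map_one] at h5
  rw [hi.1 (Ioo_subset_unitI hm)] at h3
  have h6 := hf.logD_nonpos h
  have h7 := hg.logD_nonpos hh
  constructor <;> linarith

theorem asympLogDDeriv_eq (hf : IsDiffTwoDelta f) (hg : IsDiffTwoDelta g)
    (hi : InvOn g f unitI unitI) (h : MovesTo f 0) (hd : asymptoticDistortion f = 0)
    {x : ℝ} (hx : x ∈ Ioo (0 : ℝ) 1) : asympLogDDeriv f x = asympLogDDeriv g x := by
  have hxg := ((hg.movesTo_symm hi h).resolve_left (by simp)).2 x hx
  obtain ⟨y, hxy, hyg⟩ := exists_between hxg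
  have hy : y ∈ Ioo (0 : ℝ) 1 := ⟨hx.1.trans hxy, hyg.trans (hg.mapsTo_Ioo hx).2⟩
  have hyx : f y < x := by
    have := hf.strictMonoOn (Ioo_subset_unitI hy) (hg.mapsTo (Ioo_subset_unitI hx)) hyg
    rwa [hi.2 (Ioo_subset_unitI hx)] at this
  have h1 := (hf.hasDerivAt_asympLogD hx).1
  have h2 := (hg.hasDerivAt_asympLogD hx).1
  refine h1.unique ((h2.add_const (asympLogD f y - asympLogD g y)).congr_of_eventuallyEq ?_)
  filter_upwards [Icc_mem_nhds hyx hxy] with z hz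
  have := hf.asympLogD_sub_eq hg hi h hd hy hz
  linarith

end IsDiffTwoDelta

/-! ### Vanishing distortion: construction of the flat field -/

namespace IsDiffTwoDelta

variable {f g : ℝ → ℝ} {e : ℝ}

/-- A primitive of `exp (asympLogD f)`, suitably normalized, conjugates `f` to `t ↦ t + 1`. -/
theorem exists_abel_coordinate (hf : IsDiffTwoDelta f) (h : MovesTo f 0) (h0 : logD f 0 = 0) :
    ∃ τ > 0, ∃ T : ℝ → ℝ,
      (∀ x ∈ Ioo (0 : ℝ) 1, HasDerivAt T (-(τ * Real.exp (-asympLogD f x)))⁻¹ x) ∧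
      ∀ x ∈ Ioo (0 : ℝ) 1, T (f x) = T x + 1 := by
  have hcont : ContinuousOn (fun x => Real.exp (asympLogD f x)) (Ioo 0 1) := fun x hx =>
    (hf.hasDerivAt_asympLogD hx).1.continuousAt.rexp.continuousWithinAt
  set P : ℝ → ℝ := fun x => ∫ y in (1 / 2 : ℝ)..x, Real.exp (asympLogD f y)
  have hP : ∀ x ∈ Ioo (0 : ℝ) 1, HasDerivAt P (Real.exp (asympLogD f x)) x := fun x hx =>
    intervalIntegral.integral_hasDerivAt_right
      ((hcont.mono (ordConnected_Ioo.uIcc_subset half_mem_Ioo hx)).intervalIntegrable)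
      (hcont.stronglyMeasurableAtFilter isOpen_Ioo x hx)
      (hcont.continuousAt (isOpen_Ioo.mem_nhds hx))
  have hQ : ∀ x ∈ Ioo (0 : ℝ) 1, HasDerivAt (fun x => P x - P (f x)) 0 x := fun x hx => by
    have h1 := (hP x hx).sub ((hP _ (hf.mapsTo_Ioo hx)).comp x (hf.hasDerivAt hx))
    have h2 := hf.asympLogD_map_sub h hx
    rw [← Real.exp_add, show asympLogD f (f x) + logD f x = asympLogD f x by linarith,
      sub_self] at h1
    exact h1
  set τ := P (1 / 2) - P (f (1 / 2))
  have hconst : ∀ x ∈ Ioo (0 : ℝ) 1, P x - P (f x) = τ := fun x hx =>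
    isOpen_Ioo.is_const_of_deriv_eq_zero isPreconnected_Ioo
      (fun y hy => (hQ y hy).differentiableAt.differentiableWithinAt)
      (fun y hy => (hQ y hy).deriv) hx half_mem_Ioo
  have hmono : StrictMonoOn P (Ioo 0 1) := by
    refine strictMonoOn_of_deriv_pos (convex_Ioo 0 1)
      (fun x hx => (hP x hx).continuousAt.continuousWithinAt) fun x hx => ?_
    rw [interior_Ioo] at hx
    rw [(hP x hx).deriv]
    exact Real.exp_pos _
  have hτ : 0 < τ := sub_pos.2 (hmono (hf.mapsTo_Ioo half_mem_Ioo) half_mem_Ioo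
    ((h.resolve_right (by simp)).2 _ half_mem_Ioo))
  refine ⟨τ, hτ, fun x => -P x / τ, fun x hx => ?_, fun x hx => ?_⟩
  · convert! (hP x hx).neg.div_const τ using 1
    rw [Real.exp_neg]
    field_simp
  · have := hconst x hx
    field_simp
    linarith

/-- A vector field whose time coordinate `T` conjugates `f` to `t ↦ t + 1` has a complete flow, the
time-`1` map of which is `f`. -/
theorem exists_flow_of_abel_coordinate (hf : IsDiffTwoDelta f) (hg : IsDiffTwoDelta g)
    (hi : InvOn g f unitI unitI) {X T : ℝ → ℝ}
    (hT : ∀ x ∈ Ioo (0 : ℝ) 1, HasDerivAt T (X x)⁻¹ x)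
    (hTf : ∀ x ∈ Ioo (0 : ℝ) 1, T (f x) = T x + 1)
    (hX : ∀ x ∈ Ioo (0 : ℝ) 1, X x < 0) (hX0 : X 0 = 0) (hX1 : X 1 = 0) :
    ∃ φ, IsFlowOn unitI X φ ∧ ∀ x ∈ unitI, φ 1 x = f x := by
  have hanti : StrictAntiOn T (Ioo 0 1) := by
    refine strictAntiOn_of_deriv_neg (convex_Ioo 0 1)
      (fun x hx => (hT x hx).continuousAt.continuousWithinAt) fun x hx => ?_
    rw [interior_Ioo] at hx
    rw [(hT x hx).deriv]
    exact inv_lt_zero.2 (hX x hx)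
  have hcont : ContinuousOn T (Ioo 0 1) := fun x hx => (hT x hx).continuousAt.continuousWithinAt
  have hTn : ∀ n : ℕ, T (f^[n] (1 / 2)) = T (1 / 2) + n := by
    intro n
    induction n with
    | zero => simp
    | succ n ih =>
      rw [Function.iterate_succ_apply', hTf _ (hf.iterate_mem_Ioo half_mem_Ioo n), ih]
      push_cast; ring
  have hTg : ∀ n : ℕ, T (g^[n] (1 / 2)) = T (1 / 2) - n := by
    intro n
    induction n with
    | zero => simp
    | succ n ih =>
      have h1 := hg.iterate_mem_Ioo half_mem_Ioo n
      have h2 := hTf _ (hg.mapsTo_Ioo h1)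
      rw [hi.2 (Ioo_subset_unitI h1), ih] at h2
      rw [Function.iterate_succ_apply']
      push_cast; linarith
  have hsurj : ∀ t : ℝ, ∃ x ∈ Ioo (0 : ℝ) 1, T x = t := by
    intro t
    obtain ⟨n, hn⟩ := exists_nat_ge |t - T (1 / 2)|
    have hn' := abs_le.1 hn
    exact isPreconnected_Ioo.intermediate_value₂ (hg.iterate_mem_Ioo half_mem_Ioo n)
      (hf.iterate_mem_Ioo half_mem_Ioo n) hcont continuousOn_const
      (by rw [hTg]; linarith) (by rw [hTn]; linarith)
  -- The inverse of `T`, as a continuous map from `ℝ` to `(0,1)`.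
  let o : Ioo (0 : ℝ) 1 ≃o ℝ := StrictMono.orderIsoOfSurjective (fun x => -T x)
    (fun x y hxy => neg_lt_neg (hanti x.2 y.2 hxy)) fun t => by
      obtain ⟨x, hx, hxt⟩ := hsurj (-t)
      exact ⟨⟨x, hx⟩, by simp [hxt]⟩
  set S : ℝ → ℝ := fun t => (o.symm (-t) : ℝ)
  have hSmem : ∀ t, S t ∈ Ioo (0 : ℝ) 1 := fun t => (o.symm (-t)).2
  have hTS : ∀ t, T (S t) = t := fun t => by
    have : -T (o.symm (-t)) = -t := o.apply_symm_apply (-t)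
    exact neg_injective this
  have hST : ∀ x ∈ Ioo (0 : ℝ) 1, S (T x) = x := fun x hx =>
    hanti.injOn (hSmem _) hx (hTS _)
  have hScont : Continuous S :=
    continuous_subtype_val.comp (o.symm.continuous.comp continuous_neg)
  have hSd : ∀ t, HasDerivAt S (X (S t)) t := fun t => by
    have h1 := HasDerivAt.of_local_left_inverse hScont.continuousAt (hT _ (hSmem t))
      (inv_ne_zero (hX _ (hSmem t)).ne) (Eventually.of_forall hTS)
    rwa [inv_inv] at h1
  classical
  refine ⟨fun t x => if x ∈ Ioo (0 : ℝ) 1 then S (T x + t) else x, ⟨?_, ?_, ?_⟩, ?_⟩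
  · intro t x hx
    dsimp only
    split_ifs
    exacts [Ioo_subset_unitI (hSmem _), hx]
  · intro x _
    split_ifs with hx
    · rw [add_zero, hST x hx]
    · rfl
  · intro x hxI t
    split_ifs with hx
    · exact (hSd (T x + t)).comp_const_add (T x) t
    · have hXx : X x = 0 := by
        rcases eq_or_ne x 0 with rfl | h0
        · exact hX0
        rcases eq_or_ne x 1 with rfl | h1
        · exact hX1
        exact absurd (mem_Ioo_of_ne hxI h0 h1) hx
      rw [hXx]
      exact hasDerivAt_const t x
  · intro x hxI
    dsimp only
    split_ifs with hx
    · rw [← hTf x hx, hST _ (hf.mapsTo_Ioo hx)]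
    · rcases eq_or_ne x 0 with rfl | h0
      · exact hf.map_zero.symm
      rcases eq_or_ne x 1 with rfl | h1
      · exact hf.map_one.symm
      exact absurd (mem_Ioo_of_ne hxI h0 h1) hx

/-- A vector field controlled by the displacement of `f` vanishes to first order at an endpoint
where `f` is tangent to the identity. -/
theorem hasDerivWithinAt_zero_of_le (hf : IsDiffTwoDelta f) (he : e ∈ unitI) (hfe : f e = e)
    (h0 : logD f e = 0) {X : ℝ → ℝ} {K : ℝ} (hX : ∀ x ∈ unitI, |X x| ≤ K * |f x - x|) :
    HasDerivWithinAt X 0 unitI e := by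
  have hXe : X e = 0 := by simpa [hfe] using hX e he
  have h1 := hf.hasDerivWithinAt he
  rw [← hf.exp_logD he, h0, Real.exp_zero] at h1
  have h2 := hasDerivWithinAt_iff_isLittleO.1 h1
  rw [hasDerivWithinAt_iff_isLittleO]
  refine Asymptotics.IsBigO.trans_isLittleO (Asymptotics.IsBigO.of_bound K ?_) h2
  filter_upwards [self_mem_nhdsWithin] with x hx
  simpa [hXe, hfe] using hX x hx

/-- If the asymptotic distortion vanishes, then `f` is generated by a `C¹`-flat vector field, namely
`-τ exp (-asympLogD f)`: its derivative is controlled near `0` by the forward series and near `1` by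
the backward one. -/
theorem isTimeOneOfFlatField_of_movesTo (hf : IsDiffTwoDelta f) (h : MovesTo f 0)
    (hd : asymptoticDistortion f = 0) : IsTimeOneOfFlatField f := by
  obtain ⟨g, hg, hi⟩ := hf.exists_symm
  obtain ⟨h0, h1⟩ := hf.logD_endpoints_eq_zero hg hi h hd
  obtain ⟨τ, hτ, T, hT, hTf⟩ := hf.exists_abel_coordinate h h0
  obtain ⟨C, hC⟩ := hf.exists_lipschitz_logD
  have hlt := (h.resolve_right (by simp)).2
  classical
  set Z : ℝ → ℝ := fun x => -(τ * Real.exp (-asympLogD f x)) with hZ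
  set X : ℝ → ℝ := fun x => if x ∈ Ioo (0 : ℝ) 1 then Z x else 0 with hXdef
  set X' : ℝ → ℝ := fun x => if x ∈ Ioo (0 : ℝ) 1 then -(asympLogDDeriv f x * Z x) else 0
    with hX'def
  have hXI : ∀ x ∈ Ioo (0 : ℝ) 1, X x = Z x := fun x hx => if_pos hx
  have hX'I : ∀ x ∈ Ioo (0 : ℝ) 1, X' x = -(asympLogDDeriv f x * Z x) := fun x hx => if_pos hx
  have hX0 : X 0 = 0 := if_neg (by simp)
  have hX1 : X 1 = 0 := if_neg (by simp)
  have hX'0 : X' 0 = 0 := if_neg (by simp)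
  have hX'1 : X' 1 = 0 := if_neg (by simp)
  have hZneg : ∀ x, Z x < 0 := fun x => neg_neg_of_pos (mul_pos hτ (Real.exp_pos _))
  have habs : ∀ x, |Z x| = τ * Real.exp (-asympLogD f x) := fun x => by
    rw [hZ, abs_neg, abs_of_pos (mul_pos hτ (Real.exp_pos _))]
  have hinv : ∀ x ∈ Ioo (0 : ℝ) 1, Z (f x) = Real.exp (logD f x) * Z x := fun x hx => by
    have := hf.asympLogD_map_sub h hx
    rw [hZ]
    dsimp only
    rw [show -asympLogD f (f x) = logD f x + -asympLogD f x by linarith, Real.exp_add]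
    ring
  have hbound : ∀ x ∈ Ioo (0 : ℝ) 1, |Z x| ≤ Real.exp C * |f x - x| := fun x hx => by
    -- By the mean value theorem for `T`, the displacement is the value of `Z` at some `c`.
    have hsub : Icc (f x) x ⊆ Ioo 0 1 := Icc_subset_Ioo (hf.mapsTo_Ioo hx).1 hx.2
    obtain ⟨c, hc, hc'⟩ := exists_hasDerivAt_eq_slope T (fun y => (Z y)⁻¹) (hlt x hx)
      (fun y hy => (hT y (hsub hy)).continuousAt.continuousWithinAt)
      (fun y hy => hT y (hsub (Ioo_subset_Icc_self hy)))
    rw [hTf x hx, sub_add_cancel_left, inv_eq_iff_eq_inv, inv_div, div_neg, div_one, neg_sub] at hc'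
    have h2 := hf.abs_asympLogD_sub_le hC hx
      (by rw [uIcc_of_ge (hlt x hx).le]; exact Ioo_subset_Icc_self hc)
    rw [← hc', habs, habs, mul_left_comm, ← Real.exp_add]
    refine mul_le_mul_of_nonneg_left (Real.exp_le_exp.2 ?_) hτ.le
    linarith [(abs_le.1 h2).2]
  obtain ⟨A, hA⟩ := hf.exists_abs_deriv_mul_le h hinv hbound
  have hinvg : ∀ x ∈ Ioo (0 : ℝ) 1, Z (g x) = Real.exp (logD g x) * Z x := fun x hx => by
    have h2 := hinv _ (hg.mapsTo_Ioo hx)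
    have h3 := hf.logD_symm hg hi (hg.mapsTo (Ioo_subset_unitI hx))
    rw [hi.2 (Ioo_subset_unitI hx)] at h2 h3
    rw [h3, h2, ← mul_assoc, ← Real.exp_add, neg_add_cancel, Real.exp_zero, one_mul]
  obtain ⟨M, hM⟩ := isCompact_Icc.exists_bound_of_continuousOn hf.continuousOn_logD.rexp
  have hboundg : ∀ x ∈ Ioo (0 : ℝ) 1, |Z x| ≤ M * Real.exp C * |g x - x| := fun x hx => by
    have hgx := hg.mapsTo_Ioo hx
    have h2 := hinv _ hgx
    have h3 := hbound _ hgx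
    rw [hi.2 (Ioo_subset_unitI hx)] at h2 h3
    rw [h2, abs_mul, mul_assoc, abs_sub_comm (g x)]
    exact mul_le_mul (hM _ (Ioo_subset_unitI hgx)) h3 (abs_nonneg _)
      ((norm_nonneg _).trans (hM _ (Ioo_subset_unitI hgx)))
  obtain ⟨A', hA'⟩ := hg.exists_abs_deriv_mul_le (hg.movesTo_symm hi h) hinvg hboundg
  have hboundI : ∀ x ∈ unitI, |X x| ≤ Real.exp C * |f x - x| := fun x hx => by
    by_cases hx' : x ∈ Ioo (0 : ℝ) 1
    · rw [hXI x hx']; exact hbound x hx'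
    · rw [hXdef]; dsimp only; rw [if_neg hx', abs_zero]; positivity
  have hderiv : ∀ x ∈ unitI, HasDerivWithinAt X (X' x) unitI x := fun x hx => by
    rcases eq_or_ne x 0 with rfl | hx0
    · rw [hX'0]
      exact hf.hasDerivWithinAt_zero_of_le hx hf.map_zero h0 hboundI
    rcases eq_or_ne x 1 with rfl | hx1
    · rw [hX'1]
      exact hf.hasDerivWithinAt_zero_of_le hx hf.map_one h1 hboundI
    have hx' := mem_Ioo_of_ne hx hx0 hx1
    rw [hX'I x hx']
    have h2 := ((hf.hasDerivAt_asympLogD hx').1.neg.exp.const_mul τ).neg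
    have h3 : HasDerivAt X (-(asympLogDDeriv f x * Z x)) x := by
      refine HasDerivAt.congr_of_eventuallyEq ?_
        (eventually_of_mem (isOpen_Ioo.mem_nhds hx') fun y hy => hXI y hy)
      convert! h2 using 1
      simp only [hZ, Pi.neg_apply]
      ring
    exact h3.hasDerivWithinAt
  have hcont : ContinuousOn X' unitI := fun x hx => by
    have key : ∀ e : ℝ, X' e = 0 → ∀ A : ℝ, (∀ x ∈ Ioo (0 : ℝ) 1, |X' x| ≤ A * |x - e|) →
        ContinuousWithinAt X' unitI e := fun e he A hA => by
      rw [ContinuousWithinAt, he]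
      have h2 : Tendsto (fun x : ℝ => |A| * |x - e|) (𝓝[unitI] e) (𝓝 0) := by
        have : Continuous fun x : ℝ => |A| * |x - e| := by fun_prop
        simpa using (this.tendsto e).mono_left nhdsWithin_le_nhds
      refine squeeze_zero_norm' ?_ h2
      refine Eventually.of_forall fun y => ?_
      by_cases hy : y ∈ Ioo (0 : ℝ) 1
      · exact (hA y hy).trans (mul_le_mul_of_nonneg_right (le_abs_self A) (abs_nonneg _))
      · rw [hX'def]; dsimp only; rw [if_neg hy, norm_zero]; positivity
    rcases eq_or_ne x 0 with rfl | hx0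
    · exact key 0 hX'0 A fun y hy => by rw [hX'I y hy, abs_neg]; exact hA y hy
    rcases eq_or_ne x 1 with rfl | hx1
    · refine key 1 hX'1 A' fun y hy => ?_
      rw [hX'I y hy, abs_neg, hf.asympLogDDeriv_eq hg hi h hd hy]
      exact hA' y hy
    have hx' := mem_Ioo_of_ne hx hx0 hx1
    obtain ⟨h2, h3⟩ := hf.hasDerivAt_asympLogD hx'
    refine ContinuousAt.continuousWithinAt (ContinuousAt.congr ?_
      (eventually_of_mem (isOpen_Ioo.mem_nhds hx') fun y hy => (hX'I y hy).symm))
    exact (h3.mul (h2.continuousAt.neg.rexp.const_mul τ).neg).neg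
  obtain ⟨φ, hφ, hφ1⟩ := hf.exists_flow_of_abel_coordinate hg hi (X := X) (T := T)
    (fun x hx => by rw [hXI x hx]; exact hT x hx) hTf
    (fun x hx => by rw [hXI x hx]; exact hZneg x) hX0 hX1
  have hdw : ∀ x ∈ unitI, derivWithin X unitI x = X' x := fun x hx =>
    (hderiv x hx).derivWithin (uniqueDiffOn_unitI x hx)
  refine ⟨X, φ, ⟨?_, hφ, hφ1⟩, ⟨hX0, ?_⟩, hX1, ?_⟩
  · exact (contDiffOn_one_iff_derivWithin uniqueDiffOn_unitI).2
      ⟨fun x hx => (hderiv x hx).differentiableWithinAt, hcont.congr hdw⟩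
  · rw [hdw 0 zero_mem_unitI, hX'0]
  · rw [hdw 1 one_mem_unitI, hX'1]

end IsDiffTwoDelta

/-! ### Flows of `C¹` fields and uniqueness of the generating field -/

/-- Uniqueness of solutions of the autonomous equation `u' = X(u)` for a `C¹` field on an interval,
possibly closed. -/
theorem eq_of_hasDerivAt_of_contDiffOn {J : Set ℝ} (hJ : Convex ℝ J) {X : ℝ → ℝ}
    (hX : ContDiffOn ℝ 1 X J) {u v : ℝ → ℝ} (hu : ∀ t, HasDerivAt u (X (u t)) t)
    (hv : ∀ t, HasDerivAt v (X (v t)) t) (huJ : ∀ t, u t ∈ J) (hvJ : ∀ t, v t ∈ J) {t₀ : ℝ}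
    (h : u t₀ = v t₀) : u = v := by
  have hcu : Continuous u := continuous_iff_continuousAt.2 fun t => (hu t).continuousAt
  have hcv : Continuous v := continuous_iff_continuousAt.2 fun t => (hv t).continuousAt
  have hopen : IsOpen {t | u t = v t} := by
    rw [isOpen_iff_mem_nhds]
    intro t ht
    obtain ⟨K, N, hN, hK⟩ := (hX (u t) (huJ t)).exists_lipschitzOnWith hJ
    refine ODE_solution_unique_of_eventually (v := fun _ => X) (s := fun _ => N) (K := K)
      (Eventually.of_forall fun _ => hK) ?_ ?_ ht
    · have h1 : Tendsto u (𝓝 t) (𝓝[J] (u t)) :=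
        tendsto_nhdsWithin_iff.2 ⟨hcu.tendsto t, Eventually.of_forall huJ⟩
      filter_upwards [h1 hN] with s hs using ⟨hu s, hs⟩
    · have h1 : Tendsto v (𝓝 t) (𝓝[J] (u t)) :=
        tendsto_nhdsWithin_iff.2 ⟨ht ▸ hcv.tendsto t, Eventually.of_forall hvJ⟩
      filter_upwards [h1 hN] with s hs using ⟨hv s, hs⟩
  have huniv := IsClopen.eq_univ ⟨isClosed_eq hcu hcv, hopen⟩ ⟨t₀, h⟩
  funext t
  have ht : t ∈ {t | u t = v t} := by rw [huniv]; exact mem_univ t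
  exact ht

/-- `J` is one of the intervals with endpoints `0` and `1`. -/
structure IsUnitInterval (J : Set ℝ) : Prop where
  Ioo_subset : Ioo (0 : ℝ) 1 ⊆ J
  subset_unitI : J ⊆ unitI

theorem isUnitInterval_unitI : IsUnitInterval unitI := ⟨Ioo_subset_unitI, Subset.rfl⟩
theorem isUnitInterval_Ico : IsUnitInterval (Ico 0 1) := ⟨Ioo_subset_Ico_self, Ico_subset_Icc_self⟩
theorem isUnitInterval_Ioc : IsUnitInterval (Ioc 0 1) := ⟨Ioo_subset_Ioc_self, Ioc_subset_Icc_self⟩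

namespace IsUnitInterval

variable {J : Set ℝ} (hJ : IsUnitInterval J)
include hJ

theorem convex : Convex ℝ J := by
  refine OrdConnected.convex ⟨fun x hx y hy z hz => ?_⟩
  rcases eq_or_lt_of_le hz.1 with rfl | h1
  · exact hx
  rcases eq_or_lt_of_le hz.2 with rfl | h2
  · exact hy
  exact hJ.Ioo_subset ⟨(hJ.subset_unitI hx).1.trans_lt h1, h2.trans_le (hJ.subset_unitI hy).2⟩

theorem uniqueDiffOn : UniqueDiffOn ℝ J :=
  uniqueDiffOn_convex hJ.convex
    ⟨1 / 2, mem_interior.2 ⟨_, hJ.Ioo_subset, isOpen_Ioo, half_mem_Ioo⟩⟩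

theorem mem_nhds {x : ℝ} (hx : x ∈ Ioo (0 : ℝ) 1) : J ∈ 𝓝 x :=
  mem_of_superset (isOpen_Ioo.mem_nhds hx) hJ.Ioo_subset

end IsUnitInterval

namespace Generates

variable {J : Set ℝ} {X : ℝ → ℝ} {φ : ℝ → ℝ → ℝ} {f g : ℝ → ℝ} {e : ℝ}

theorem mem (F : Generates J X φ f) {x : ℝ} (hx : x ∈ J) (t : ℝ) : φ t x ∈ J :=
  F.isFlowOn.mapsTo t hx

theorem continuous_flow (F : Generates J X φ f) {x : ℝ} (hx : x ∈ J) :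
    Continuous fun t => φ t x :=
  continuous_iff_continuousAt.2 fun t => (F.isFlowOn.hasDerivAt x hx t).continuousAt

theorem flow_eq (F : Generates J X φ f) (hJ : IsUnitInterval J) {x : ℝ} (hx : x ∈ J) {u : ℝ → ℝ}
    (hu : ∀ t, HasDerivAt u (X (u t)) t) (huJ : ∀ t, u t ∈ J) {t₀ : ℝ} (h : φ t₀ x = u t₀) (t : ℝ) :
    φ t x = u t :=
  congrFun (eq_of_hasDerivAt_of_contDiffOn hJ.convex F.contDiffOn
    (F.isFlowOn.hasDerivAt x hx) hu (F.mem hx) huJ h) t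

theorem flow_add (F : Generates J X φ f) (hJ : IsUnitInterval J) {x : ℝ} (hx : x ∈ J) (s t : ℝ) :
    φ (s + t) x = φ s (φ t x) := by
  refine (F.flow_eq hJ (F.mem hx t) (u := fun s => φ (s + t) x) (t₀ := 0) (fun r => ?_)
    (fun r => F.mem hx _) ?_ s).symm
  · exact (F.isFlowOn.hasDerivAt x hx (r + t)).comp_add_const r t
  · rw [F.isFlowOn.zero _ (F.mem hx t), zero_add]

theorem map_flow (F : Generates J X φ f) (hJ : IsUnitInterval J) {x : ℝ} (hx : x ∈ J) (t : ℝ) :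
    f (φ t x) = φ (t + 1) x := by
  rw [add_comm, F.flow_add hJ hx, F.time_one _ (F.mem hx t)]

theorem flow_const (F : Generates J X φ f) (hJ : IsUnitInterval J) {x y : ℝ} (hx : x ∈ J)
    (hy : X y = 0) {t₀ : ℝ} (h : φ t₀ x = y) (t : ℝ) : φ t x = y :=
  F.flow_eq hJ hx (u := fun _ => y) (fun t => by rw [hy]; exact hasDerivAt_const t y)
    (fun _ => h ▸ F.mem hx t₀) h t

/-- At an endpoint of `[0,1]` reached by a trajectory, the vector field vanishes, because the
trajectory stays in `[0,1]`. -/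
theorem eq_zero_of_flow_eq (F : Generates J X φ f) (hJ : IsUnitInterval J) {x t : ℝ} (hx : x ∈ J)
    (he : e = 0 ∨ e = 1) (h : φ t x = e) : X e = 0 := by
  have hd := F.isFlowOn.hasDerivAt x hx t
  rw [h] at hd
  have hm := fun s => hJ.subset_unitI (F.mem hx s)
  rcases he with rfl | rfl
  · refine IsLocalMin.hasDerivAt_eq_zero (Eventually.of_forall fun s => ?_) hd
    rw [h]; exact (hm s).1
  · refine IsLocalMax.hasDerivAt_eq_zero (Eventually.of_forall fun s => ?_) hd
    rw [h]; exact (hm s).2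

theorem apply_endpoint (F : Generates J X φ f) (hJ : IsUnitInterval J) (heJ : e ∈ J)
    (he : e = 0 ∨ e = 1) : X e = 0 :=
  F.eq_zero_of_flow_eq hJ heJ he (F.isFlowOn.zero e heJ)

theorem flow_endpoint (F : Generates J X φ f) (hJ : IsUnitInterval J) (heJ : e ∈ J)
    (he : e = 0 ∨ e = 1) (t : ℝ) : φ t e = e :=
  F.flow_const hJ heJ (F.apply_endpoint hJ heJ he) (F.isFlowOn.zero e heJ) t

theorem ne_zero (F : Generates J X φ f) (hJ : IsUnitInterval J) (hf : IsDiffTwoDelta f) {x : ℝ}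
    (hx : x ∈ Ioo (0 : ℝ) 1) : X x ≠ 0 := fun h => by
  have hxJ := hJ.Ioo_subset hx
  refine hf.no_fixed_point x hx ?_
  rw [← F.time_one x hxJ]
  exact F.flow_const hJ hxJ h (F.isFlowOn.zero x hxJ) 1

theorem flow_mem_Ioo (F : Generates J X φ f) (hJ : IsUnitInterval J) {x : ℝ}
    (hx : x ∈ Ioo (0 : ℝ) 1) (t : ℝ) : φ t x ∈ Ioo (0 : ℝ) 1 := by
  have hxJ := hJ.Ioo_subset hx
  have key : ∀ e : ℝ, e = 0 ∨ e = 1 → φ t x ≠ e := fun e he h => by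
    have h1 := F.flow_const hJ hxJ (F.eq_zero_of_flow_eq hJ hxJ he h) h 0
    rw [F.isFlowOn.zero x hxJ] at h1
    rcases he with rfl | rfl
    exacts [hx.1.ne' h1, hx.2.ne h1]
  exact mem_Ioo_of_ne (hJ.subset_unitI (F.mem hxJ t)) (key 0 (Or.inl rfl)) (key 1 (Or.inr rfl))

theorem flow_injective (F : Generates J X φ f) (hJ : IsUnitInterval J) (hf : IsDiffTwoDelta f)
    {x : ℝ} (hx : x ∈ Ioo (0 : ℝ) 1) : Function.Injective fun t => φ t x := by
  have hxJ := hJ.Ioo_subset hx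
  have key : ∀ s t : ℝ, s < t → φ s x ≠ φ t x := fun s t hst h => by
    obtain ⟨c, -, hc⟩ := exists_hasDerivAt_eq_zero hst (F.continuous_flow hxJ).continuousOn h
      (fun r _ => F.isFlowOn.hasDerivAt x hxJ r)
    exact F.ne_zero hJ hf (F.flow_mem_Ioo hJ hx c) hc
  intro s t h
  by_contra hst
  rcases lt_or_gt_of_ne hst with h1 | h1
  exacts [key s t h1 h, key t s h1 h.symm]

theorem flow_monotone_or_antitone (F : Generates J X φ f) (hJ : IsUnitInterval J)
    (hf : IsDiffTwoDelta f) {x : ℝ} (hx : x ∈ Ioo (0 : ℝ) 1) :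
    (StrictMono fun t => φ t x) ∨ StrictAnti fun t => φ t x :=
  (F.continuous_flow (hJ.Ioo_subset hx)).strictMono_of_inj (F.flow_injective hJ hf hx)

theorem flow_nat (F : Generates J X φ f) (hJ : IsUnitInterval J) {x : ℝ} (hx : x ∈ J) (n : ℕ) :
    φ n x = f^[n] x := by
  induction n with
  | zero => simpa using F.isFlowOn.zero x hx
  | succ n ih => rw [Function.iterate_succ_apply', ← ih, F.map_flow hJ hx, Nat.cast_succ]

theorem flow_neg_nat (F : Generates J X φ f) (hJ : IsUnitInterval J) (hi : InvOn g f unitI unitI)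
    {x : ℝ} (hx : x ∈ J) (n : ℕ) : φ (-n) x = g^[n] x := by
  induction n with
  | zero => simpa using F.isFlowOn.zero x hx
  | succ n ih =>
    rw [Function.iterate_succ_apply', ← ih]
    have h1 := F.map_flow hJ hx (-(n + 1 : ℕ))
    rw [Nat.cast_succ, neg_add, neg_add_cancel_right] at h1
    rw [← h1, Nat.cast_succ, neg_add, hi.1 (hJ.subset_unitI (F.mem hx _))]

/-- Each endpoint of `[0,1]` is the limit of every trajectory in `(0,1)`, along positive or negative
integer times. -/
theorem exists_tendsto_flow (F : Generates J X φ f) (hJ : IsUnitInterval J)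
    (hf : IsDiffTwoDelta f) (he : e = 0 ∨ e = 1) : ∃ s : ℕ → ℝ,
      (s = (fun n : ℕ => (n : ℝ)) ∨ s = fun n : ℕ => -(n : ℝ)) ∧
        ∀ x ∈ Ioo (0 : ℝ) 1, Tendsto (fun n => φ (s n) x) atTop (𝓝 e) := by
  obtain ⟨g, hg, hi⟩ := hf.exists_symm
  have h : MovesTo f e ∨ MovesTo g e := by
    rcases hf.exists_movesTo with h | h <;> rcases he with rfl | rfl
    exacts [Or.inl h, Or.inr (hg.movesTo_symm hi h), Or.inr (hg.movesTo_symm' hi h), Or.inl h]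
  rcases h with h | h
  · refine ⟨_, Or.inl rfl, fun x hx => ?_⟩
    simp only [F.flow_nat hJ (hJ.Ioo_subset hx)]
    exact hf.tendsto_iterate h hx
  · refine ⟨_, Or.inr rfl, fun x hx => ?_⟩
    simp only [F.flow_neg_nat hJ hi (hJ.Ioo_subset hx)]
    exact hg.tendsto_iterate h hx

theorem exists_flow_eq (F : Generates J X φ f) (hJ : IsUnitInterval J) (hf : IsDiffTwoDelta f)
    {x y : ℝ} (hx : x ∈ Ioo (0 : ℝ) 1) (hy : y ∈ Ioo (0 : ℝ) 1) : ∃ t, φ t x = y := by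
  obtain ⟨s, -, hs⟩ := F.exists_tendsto_flow hJ hf (Or.inl rfl)
  obtain ⟨r, -, hr⟩ := F.exists_tendsto_flow hJ hf (Or.inr rfl)
  obtain ⟨n, hn⟩ := ((hs x hx).eventually (gt_mem_nhds hy.1)).exists
  obtain ⟨m, hm⟩ := ((hr x hx).eventually (lt_mem_nhds hy.2)).exists
  exact mem_range_of_exists_le_of_exists_ge (F.continuous_flow (hJ.Ioo_subset hx))
    ⟨_, hn.le⟩ ⟨_, hm.le⟩

theorem hasDerivAt_field (F : Generates J X φ f) (hJ : IsUnitInterval J) {x : ℝ}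
    (hx : x ∈ Ioo (0 : ℝ) 1) : HasDerivAt X (derivWithin X J x) x :=
  (F.contDiffOn.differentiableOn (by norm_num) x
    (hJ.Ioo_subset hx)).hasDerivWithinAt.hasDerivAt (hJ.mem_nhds hx)

/-- The invariance of `X` under `f`, in logarithmic form. (`Real.log` is the logarithm of the
absolute value.) -/
theorem log_map (F : Generates J X φ f) (hJ : IsUnitInterval J) (hf : IsDiffTwoDelta f) {x : ℝ}
    (hx : x ∈ Ioo (0 : ℝ) 1) :
    Real.log (X (f x)) = logD f x + Real.log (X x) := by
  have hxJ := hJ.Ioo_subset hx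
  have h1 := (F.isFlowOn.hasDerivAt x hxJ (0 + 1)).comp_add_const 0 1
  have h2 := F.isFlowOn.hasDerivAt x hxJ 0
  rw [F.isFlowOn.zero x hxJ] at h2
  have h3 : HasDerivAt f (Real.exp (logD f x)) (φ 0 x) := by
    rw [F.isFlowOn.zero x hxJ]
    exact hf.hasDerivAt hx
  have h4 := h3.comp 0 h2
  have h5 : (f ∘ fun s => φ s x) = fun s => φ (s + 1) x := funext fun s => F.map_flow hJ hxJ s
  rw [h5] at h4
  have h6 := h1.unique h4
  rw [zero_add, F.time_one x hxJ] at h6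
  rw [h6, Real.log_mul (Real.exp_pos _).ne' (F.ne_zero hJ hf hx), Real.log_exp]

theorem hasDerivAt_log_flow (F : Generates J X φ f) (hJ : IsUnitInterval J)
    (hf : IsDiffTwoDelta f) {x : ℝ} (hx : x ∈ Ioo (0 : ℝ) 1) (t : ℝ) :
    HasDerivAt (fun t => Real.log (X (φ t x))) (derivWithin X J (φ t x)) t := by
  have ht := F.flow_mem_Ioo hJ hx t
  have h1 := ((F.hasDerivAt_field hJ ht).comp t
    (F.isFlowOn.hasDerivAt x (hJ.Ioo_subset hx) t)).log (F.ne_zero hJ hf ht)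
  convert! h1 using 1
  have := F.ne_zero hJ hf ht
  simp only [Function.comp_apply]
  field_simp

theorem flow_mem_uIcc (F : Generates J X φ f) (hJ : IsUnitInterval J) (hf : IsDiffTwoDelta f)
    {x : ℝ} (hx : x ∈ Ioo (0 : ℝ) 1) {t : ℝ} (ht : t ∈ Icc (0 : ℝ) 1) :
    φ t x ∈ uIcc x (f x) := by
  have hxJ := hJ.Ioo_subset hx
  have key : φ t x ∈ uIcc (φ 0 x) (φ 1 x) := by
    rcases F.flow_monotone_or_antitone hJ hf hx with h | h
    · exact Icc_subset_uIcc ⟨h.monotone ht.1, h.monotone ht.2⟩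
    · exact Icc_subset_uIcc' ⟨h.antitone ht.2, h.antitone ht.1⟩
  rwa [F.isFlowOn.zero x hxJ, F.time_one x hxJ] at key

theorem exists_logD_eq (F : Generates J X φ f) (hJ : IsUnitInterval J) (hf : IsDiffTwoDelta f)
    {x : ℝ} (hx : x ∈ Ioo (0 : ℝ) 1) : ∃ y ∈ uIcc x (f x), logD f x = derivWithin X J y := by
  have hxJ := hJ.Ioo_subset hx
  obtain ⟨c, hc, hc'⟩ := exists_hasDerivAt_eq_slope _ _ zero_lt_one
    (fun t _ => (F.hasDerivAt_log_flow hJ hf hx t).continuousAt.continuousWithinAt)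
    (fun t _ => F.hasDerivAt_log_flow hJ hf hx t)
  refine ⟨φ c x, F.flow_mem_uIcc hJ hf hx (Ioo_subset_Icc_self hc), ?_⟩
  rw [hc', F.time_one x hxJ, F.isFlowOn.zero x hxJ, F.log_map hJ hf hx]
  ring

theorem continuousOn_deriv (F : Generates J X φ f) (hJ : IsUnitInterval J) :
    ContinuousOn (derivWithin X J) J :=
  F.contDiffOn.continuousOn_derivWithin hJ.uniqueDiffOn le_rfl

theorem tendsto_deriv_of_mem_uIcc (F : Generates J X φ f) (hJ : IsUnitInterval J)
    (hf : IsDiffTwoDelta f) (heJ : e ∈ J) (he : e = 0 ∨ e = 1) {x y : ℕ → ℝ}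
    (hx : ∀ n, x n ∈ Ioo (0 : ℝ) 1) (hxe : Tendsto x atTop (𝓝 e))
    (hy : ∀ n, y n ∈ uIcc (x n) (f (x n))) :
    Tendsto (fun n => derivWithin X J (y n)) atTop (𝓝 (derivWithin X J e)) := by
  have hfe : f e = e := by
    rcases he with rfl | rfl
    exacts [hf.map_zero, hf.map_one]
  have h1 : Tendsto (fun n => f (x n)) atTop (𝓝 e) := by
    have := (hf.continuousOn e (hJ.subset_unitI heJ)).tendsto.comp (tendsto_nhdsWithin_iff.2
      ⟨hxe, Eventually.of_forall fun n => Ioo_subset_unitI (hx n)⟩)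
    rwa [hfe] at this
  have hmin := hxe.min h1
  have hmax := hxe.max h1
  rw [min_self] at hmin
  rw [max_self] at hmax
  have hye := tendsto_of_tendsto_of_tendsto_of_le_of_le hmin hmax (fun n => (hy n).1)
    fun n => (hy n).2
  have hyJ : ∀ n, y n ∈ J := fun n => hJ.Ioo_subset
    (ordConnected_Ioo.uIcc_subset (hx n) (hf.mapsTo_Ioo (hx n)) (hy n))
  exact (F.continuousOn_deriv hJ e heJ).tendsto.comp
    (tendsto_nhdsWithin_iff.2 ⟨hye, Eventually.of_forall hyJ⟩)

/-- At an endpoint, the derivative of the time-`1` map is the exponential of that of the field. -/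
theorem logD_endpoint (F : Generates J X φ f) (hJ : IsUnitInterval J) (hf : IsDiffTwoDelta f)
    (heJ : e ∈ J) (he : e = 0 ∨ e = 1) : logD f e = derivWithin X J e := by
  obtain ⟨s, -, hs⟩ := F.exists_tendsto_flow hJ hf he
  have hx := fun n => F.flow_mem_Ioo hJ half_mem_Ioo (s n)
  choose y hy hy' using fun n => F.exists_logD_eq hJ hf (hx n)
  have h1 := F.tendsto_deriv_of_mem_uIcc hJ hf heJ he hx (hs _ half_mem_Ioo) hy
  simp only [← hy'] at h1
  exact tendsto_nhds_unique ((hf.continuousOn_logD e (hJ.subset_unitI heJ)).tendsto.comp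
    (tendsto_nhdsWithin_iff.2 ⟨hs _ half_mem_Ioo,
      Eventually.of_forall fun n => Ioo_subset_unitI (hx n)⟩)) h1

theorem field_mul_pos (F : Generates J X φ f) (hJ : IsUnitInterval J) (hf : IsDiffTwoDelta f)
    {x y : ℝ} (hx : x ∈ Ioo (0 : ℝ) 1) (hy : y ∈ Ioo (0 : ℝ) 1) : 0 < X x * X y := by
  have hc : ContinuousOn X (Ioo 0 1) := F.contDiffOn.continuousOn.mono hJ.Ioo_subset
  have key : ∀ x ∈ Ioo (0 : ℝ) 1, ∀ y ∈ Ioo (0 : ℝ) 1, X x < 0 → 0 < X y → False := by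
    intro x hx y hy h1 h2
    obtain ⟨z, hz, hz'⟩ := isPreconnected_Ioo.intermediate_value₂ hx hy hc continuousOn_const
      h1.le h2.le
    exact F.ne_zero hJ hf hz hz'
  rcases lt_or_gt_of_ne (F.ne_zero hJ hf hx) with h1 | h1 <;>
    rcases lt_or_gt_of_ne (F.ne_zero hJ hf hy) with h2 | h2
  · exact mul_pos_of_neg_of_neg h1 h2
  · exact (key x hx y hy h1 h2).elim
  · exact (key y hy x hx h2 h1).elim
  · exact mul_pos h1 h2

/-- The field `X` compared with the displacement `f - id`, which is a value of `X` along the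
trajectory from `x` to `f x`. -/
theorem exists_abs_log_sub_le (F : Generates J X φ f) (hJ : IsUnitInterval J)
    (hf : IsDiffTwoDelta f) {x : ℝ} (hx : x ∈ Ioo (0 : ℝ) 1) : 0 < X x * (f x - x) ∧
      ∃ y ∈ uIcc x (f x), |Real.log (X x) - Real.log (f x - x)| ≤ |derivWithin X J y| := by
  have hxJ := hJ.Ioo_subset hx
  obtain ⟨c, hc, hc'⟩ := exists_hasDerivAt_eq_slope _ _ zero_lt_one
    (F.continuous_flow hxJ).continuousOn (fun t _ => F.isFlowOn.hasDerivAt x hxJ t)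
  rw [F.time_one x hxJ, F.isFlowOn.zero x hxJ, sub_zero, div_one] at hc'
  refine ⟨hc' ▸ F.field_mul_pos hJ hf hx (F.flow_mem_Ioo hJ hx c), ?_⟩
  obtain ⟨r, hr, hr'⟩ := exists_hasDerivAt_eq_slope _ _ hc.1
    (fun t _ => (F.hasDerivAt_log_flow hJ hf hx t).continuousAt.continuousWithinAt)
    (fun t _ => F.hasDerivAt_log_flow hJ hf hx t)
  refine ⟨φ r x, F.flow_mem_uIcc hJ hf hx ⟨hr.1.le, (hr.2.trans hc.2).le⟩, ?_⟩
  rw [hr', hc', F.isFlowOn.zero x hxJ, sub_zero, abs_div, abs_of_pos hc.1, abs_sub_comm]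
  exact le_div_self (abs_nonneg _) hc.1 hc.2.le

/-- Uniqueness of the generating field: two `C¹` fields near an endpoint `e` which generate the same
`f`, tangent to the identity at `e`, coincide. Both are asymptotic to `f - id` at `e`, and their
ratio is `f`-invariant. -/
theorem field_unique {J' : Set ℝ} {X' : ℝ → ℝ} {φ' : ℝ → ℝ → ℝ} (F : Generates J X φ f)
    (F' : Generates J' X' φ' f) (hJ : IsUnitInterval J) (hJ' : IsUnitInterval J')
    (hf : IsDiffTwoDelta f) (heJ : e ∈ J) (heJ' : e ∈ J') (he : e = 0 ∨ e = 1)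
    (h0 : logD f e = 0) : EqOn X X' (Ioo 0 1) := by
  intro x hx
  obtain ⟨s, hs, hse⟩ := F.exists_tendsto_flow hJ hf he
  have hxJ := hJ.Ioo_subset hx
  set d : ℝ → ℝ := fun y => Real.log (X y) - Real.log (X' y) with hd
  have hmem := fun t => F.flow_mem_Ioo hJ hx t
  have hinv : ∀ t, d (φ (t + 1) x) = d (φ t x) := fun t => by
    rw [← F.map_flow hJ hxJ, hd]
    simp only [F.log_map hJ hf (hmem t), F'.log_map hJ' hf (hmem t)]
    ring
  have hdn : ∀ n : ℕ, d (φ (s n) x) = d x := by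
    have h1 : ∀ n : ℕ, d (φ n x) = d x ∧ d (φ (-n) x) = d x := by
      intro n
      induction n with
      | zero => simp [F.isFlowOn.zero x hxJ]
      | succ n ih =>
        rw [Nat.cast_succ, hinv, ← hinv (-(n + 1)), neg_add, neg_add_cancel_right]
        exact ih
    rcases hs with rfl | rfl
    exacts [fun n => (h1 n).1, fun n => (h1 n).2]
  have key : ∀ {J : Set ℝ} {X : ℝ → ℝ} {φ' : ℝ → ℝ → ℝ}, Generates J X φ' f → IsUnitInterval J →
      e ∈ J → Tendsto (fun n => Real.log (X (φ (s n) x)) -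
        Real.log (f (φ (s n) x) - φ (s n) x)) atTop (𝓝 0) := by
    intro J X φ' F hJ heJ
    choose y hy hy' using fun n => (F.exists_abs_log_sub_le hJ hf (hmem (s n))).2
    have h1 := F.tendsto_deriv_of_mem_uIcc hJ hf heJ he (fun n => hmem (s n)) (hse x hx) hy
    rw [← F.logD_endpoint hJ hf heJ he, h0] at h1
    exact squeeze_zero_norm hy' (by simpa using h1.abs)
  have h1 := (key F hJ heJ).sub (key F' hJ' heJ')
  have h2 : ∀ n, Real.log (X (φ (s n) x)) - Real.log (f (φ (s n) x) - φ (s n) x) -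
      (Real.log (X' (φ (s n) x)) - Real.log (f (φ (s n) x) - φ (s n) x)) = d x := fun n => by
    rw [← hdn n, hd]
    ring
  simp only [h2, sub_zero] at h1
  have h3 : d x = 0 := tendsto_nhds_unique tendsto_const_nhds h1
  have h4 := (F.exists_abs_log_sub_le hJ hf hx).1
  have h5 := (F'.exists_abs_log_sub_le hJ' hf hx).1
  have h6 := sub_eq_zero.1 h3
  rcases lt_or_gt_of_ne (sub_ne_zero.2 (hf.no_fixed_point x hx)) with h | h
  · have h7 : X x < 0 := neg_of_mul_pos_left h4 h.le
    have h8 : X' x < 0 := neg_of_mul_pos_left h5 h.le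
    rw [← Real.log_neg_eq_log, ← Real.log_neg_eq_log (X' x)] at h6
    exact neg_injective (Real.log_injOn_pos (neg_pos.2 h7) (neg_pos.2 h8) h6)
  · exact Real.log_injOn_pos (pos_of_mul_pos_left h4 h.le) (pos_of_mul_pos_left h5 h.le) h6

end Generates

/-! ### The equivalences -/

theorem IsTimeOneOfFlatField.symm {f g : ℝ → ℝ} (h : IsTimeOneOfFlatField g)
    (hi : InvOn g f unitI unitI) : IsTimeOneOfFlatField f := by
  obtain ⟨X, φ, F, ⟨h0, h0'⟩, h1, h1'⟩ := h
  refine ⟨fun x => -X x, fun t => φ (-t), ⟨F.contDiffOn.neg,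
    ⟨fun t => F.isFlowOn.mapsTo (-t), fun x hx => ?_, fun x hx t => ?_⟩, fun x hx => ?_⟩,
    ⟨by simp [h0], ?_⟩, by simp [h1], ?_⟩
  · simpa using F.isFlowOn.zero x hx
  · have h2 := (F.isFlowOn.hasDerivAt x hx (-t)).comp t (hasDerivAt_neg t)
    simpa [Function.comp_def] using h2
  · have h2 := F.map_flow isUnitInterval_unitI hx (-1)
    rw [neg_add_cancel, F.isFlowOn.zero x hx] at h2
    rw [← hi.2 (F.mem hx (-1)), h2]
  · rw [derivWithin.fun_neg, h0', neg_zero]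
  · rw [derivWithin.fun_neg, h1', neg_zero]

namespace Generates

variable {X : ℝ → ℝ} {φ : ℝ → ℝ → ℝ} {f : ℝ → ℝ}

theorem parabolicEndpoints (F : Generates unitI X φ f) (hf : IsDiffTwoDelta f)
    (h0 : derivWithin X unitI 0 = 0) (h1 : derivWithin X unitI 1 = 0) : ParabolicEndpoints f := by
  have e0 := F.logD_endpoint isUnitInterval_unitI hf zero_mem_unitI (Or.inl rfl)
  have e1 := F.logD_endpoint isUnitInterval_unitI hf one_mem_unitI (Or.inr rfl)
  constructor
  · rw [← hf.exp_logD zero_mem_unitI, e0, h0, Real.exp_zero]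
  · rw [← hf.exp_logD one_mem_unitI, e1, h1, Real.exp_zero]

theorem isLeftSzekeres (F : Generates unitI X φ f) :
    IsLeftSzekeres f X φ := by
  have hJ := isUnitInterval_unitI
  refine ⟨⟨F.contDiffOn.mono Ico_subset_Icc_self, ⟨fun t x hx => ?_,
    fun x hx => F.isFlowOn.zero x (Ico_subset_Icc_self hx),
    fun x hx => F.isFlowOn.hasDerivAt x (Ico_subset_Icc_self hx)⟩,
    fun x hx => F.time_one x (Ico_subset_Icc_self hx)⟩, X 1, ?_⟩
  · rcases eq_or_lt_of_le hx.1 with rfl | h0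
    · rw [F.flow_endpoint hJ zero_mem_unitI (Or.inl rfl)]
      exact hx
    · exact Ioo_subset_Ico_self (F.flow_mem_Ioo hJ ⟨h0, hx.2⟩ t)
  · have h1 := (F.contDiffOn.continuousOn 1 one_mem_unitI).mono Ico_subset_Icc_self
    rwa [ContinuousWithinAt, nhdsWithin_Ico_eq_nhdsLT zero_lt_one] at h1

theorem isRightSzekeres (F : Generates unitI X φ f) :
    IsRightSzekeres f X φ := by
  have hJ := isUnitInterval_unitI
  refine ⟨⟨F.contDiffOn.mono Ioc_subset_Icc_self, ⟨fun t x hx => ?_,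
    fun x hx => F.isFlowOn.zero x (Ioc_subset_Icc_self hx),
    fun x hx => F.isFlowOn.hasDerivAt x (Ioc_subset_Icc_self hx)⟩,
    fun x hx => F.time_one x (Ioc_subset_Icc_self hx)⟩, X 0, ?_⟩
  · rcases eq_or_lt_of_le hx.2 with rfl | h1
    · rw [F.flow_endpoint hJ one_mem_unitI (Or.inr rfl)]
      exact hx
    · exact Ioo_subset_Ioc_self (F.flow_mem_Ioo hJ ⟨hx.1, h1⟩ t)
  · have h1 := (F.contDiffOn.continuousOn 0 zero_mem_unitI).mono Ioc_subset_Icc_self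
    rwa [ContinuousWithinAt, nhdsWithin_Ioc_eq_nhdsGT zero_lt_one] at h1

/-- A field which agrees in `(0,1)` with a field on `[0,1]` has the same flow there. -/
theorem flow_eq_of_eqOn {J : Set ℝ} {Y : ℝ → ℝ} {χ : ℝ → ℝ → ℝ} (F : Generates unitI X φ f)
    (G : Generates J Y χ f) (hJ : IsUnitInterval J) (h : EqOn Y X (Ioo 0 1)) {x : ℝ}
    (hx : x ∈ Ioo (0 : ℝ) 1) (t : ℝ) : χ t x = φ t x := by
  have hxJ := hJ.Ioo_subset hx
  have hxI := Ioo_subset_unitI hx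
  refine (F.flow_eq isUnitInterval_unitI hxI (u := fun t => χ t x) (t₀ := 0) (fun s => ?_)
    (fun s => hJ.subset_unitI (G.mem hxJ s)) ?_ t).symm
  · rw [← h (G.flow_mem_Ioo hJ hx s)]
    exact G.isFlowOn.hasDerivAt x hxJ s
  · rw [F.isFlowOn.zero x hxI, G.isFlowOn.zero x hxJ]

theorem trivialMatherInvariant (F : Generates unitI X φ f) (hf : IsDiffTwoDelta f)
    (h0 : derivWithin X unitI 0 = 0) (h1 : derivWithin X unitI 1 = 0) :
    TrivialMatherInvariant f := by
  have hJ := isUnitInterval_unitI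
  have e0 := F.logD_endpoint hJ hf zero_mem_unitI (Or.inl rfl)
  have e1 := F.logD_endpoint hJ hf one_mem_unitI (Or.inr rfl)
  rw [h0] at e0
  rw [h1] at e1
  refine Subset.antisymm ?_ ?_
  · rintro _ ⟨a, ha, b, hb, M, ⟨Y₁, Y₂, φ₁, φ₂, ⟨F₁, -⟩, ⟨F₂, -⟩, hM⟩, c, d, rfl⟩
    have hY₁ := F₁.field_unique F isUnitInterval_Ico hJ hf (e := 0) (by simp) zero_mem_unitI
      (Or.inl rfl) e0
    have hY₂ := F₂.field_unique F isUnitInterval_Ioc hJ hf (e := 1) (by simp) one_mem_unitI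
      (Or.inr rfl) e1
    obtain ⟨s, rfl⟩ := F.exists_flow_eq hJ hf ha hb
    have hM' : ∀ t, M t = t - s := fun t => by
      have h2 := hM t
      rw [F.flow_eq_of_eqOn F₁ isUnitInterval_Ico hY₁ ha,
        F.flow_eq_of_eqOn F₂ isUnitInterval_Ioc hY₂ hb,
        ← F.flow_add hJ (Ioo_subset_unitI ha)] at h2
      exact eq_sub_of_add_eq (F.flow_injective hJ hf ha h2)
    refine ⟨c - s + d, funext fun t => ?_⟩
    rw [hM']
    ring
  · rintro _ ⟨c, rfl⟩
    exact ⟨1 / 2, half_mem_Ioo, 1 / 2, half_mem_Ioo, id, ⟨X, X, φ, φ, F.isLeftSzekeres,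
      F.isRightSzekeres, fun t => rfl⟩, 0, c, by simp⟩

theorem log_iterate (F : Generates unitI X φ f) (hf : IsDiffTwoDelta f) {x : ℝ}
    (hx : x ∈ Ioo (0 : ℝ) 1) (n : ℕ) :
    birkhoffSum f (logD f) n x = Real.log (X (f^[n] x)) - Real.log (X x) := by
  induction n with
  | zero => simp
  | succ n ih =>
    rw [birkhoffSum_succ, ih, Function.iterate_succ_apply',
      F.log_map isUnitInterval_unitI hf (hf.iterate_mem_Ioo hx n)]
    ring

theorem iterate_flow {J : Set ℝ} (F : Generates J X φ f) (hJ : IsUnitInterval J) {x : ℝ}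
    (hx : x ∈ J) (n : ℕ) (t : ℝ) : f^[n] (φ t x) = φ (t + n) x := by
  rw [add_comm, F.flow_add hJ hx, F.flow_nat hJ (F.mem hx t)]

end Generates

theorem eVariationOn_Icc_add_Icc (u : ℝ → ℝ) {a b c : ℝ} (hab : a ≤ b) (hbc : b ≤ c) :
    eVariationOn u (Icc a b) + eVariationOn u (Icc b c) = eVariationOn u (Icc a c) := by
  simpa using eVariationOn.Icc_add_Icc u hab hbc (mem_univ b)

theorem eVariationOn_Icc_le_of_hasDerivAt {w w' : ℝ → ℝ} (hw : ∀ t, HasDerivAt w (w' t) t)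
    {a b B : ℝ} (hB : 0 ≤ B) (hb : ∀ t ∈ Icc a b, |w' t| ≤ B) :
    eVariationOn w (Icc a b) ≤ ENNReal.ofReal (B * (b - a)) := by
  lift B to NNReal using hB
  exact ((convex_Icc a b).lipschitzOnWith_of_nnnorm_hasDerivWithin_le
    (fun t _ => (hw t).hasDerivWithinAt) fun t ht => hb t ht).eVariationOn_Icc_le

/-- The time-`1` map of a `C¹`-flat field has vanishing distortion. In the time coordinate `t`,
`log Dfⁿ` is `w (t + n) - w t` with `w = log |X|`, and `w' → 0` at both ends by flatness. Hence the
variation over the times in `[-N - n, N]` is `o(n)`; the rest of `[0,1]` consists of two intervals the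
first `n` iterates of which stay near the endpoints. -/
theorem Generates.asymptoticDistortion_eq_zero {X : ℝ → ℝ} {φ : ℝ → ℝ → ℝ} {f : ℝ → ℝ}
    (F : Generates unitI X φ f) (hf : IsDiffTwoDelta f) (h : MovesTo f 0)
    (h0 : derivWithin X unitI 0 = 0) (h1 : derivWithin X unitI 1 = 0) :
    asymptoticDistortion f = 0 := by
  have hJ := isUnitInterval_unitI
  obtain ⟨g, hg, hi⟩ := hf.exists_symm
  obtain ⟨C, hC⟩ := hf.exists_lipschitz_logD
  have hcont := F.continuousOn_deriv hJ
  obtain ⟨B, hB⟩ := isCompact_Icc.exists_bound_of_continuousOn hcont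
  have hB0 : 0 ≤ B := (norm_nonneg _).trans (hB 0 zero_mem_unitI)
  have haI := Ioo_subset_unitI half_mem_Ioo
  set ψ : ℝ → ℝ := fun t => φ t (1 / 2)
  set w : ℝ → ℝ := fun t => Real.log (X (ψ t))
  have hψmem : ∀ t, ψ t ∈ Ioo (0 : ℝ) 1 := F.flow_mem_Ioo hJ half_mem_Ioo
  have hw : ∀ t, HasDerivAt w (derivWithin X unitI (ψ t)) t :=
    F.hasDerivAt_log_flow hJ hf half_mem_Ioo
  have hanti : StrictAnti ψ := by
    refine (F.flow_monotone_or_antitone hJ hf half_mem_Ioo).resolve_left fun hm => ?_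
    have h2 : φ 0 (1 / 2) < φ 1 (1 / 2) := hm zero_lt_one
    rw [F.isFlowOn.zero _ haI, F.time_one _ haI] at h2
    exact lt_asymm h2 ((h.resolve_right (by simp)).2 _ half_mem_Ioo)
  have main : ∀ ε : ℝ, 0 < ε → asymptoticDistortion f ≤ ENNReal.ofReal ((2 * C + 2) * ε) := by
    intro ε hε
    -- Beyond the time `N` the trajectory of `1/2` is close to the endpoints.
    have hnear : ∀ e ∈ unitI, derivWithin X unitI e = 0 →
        ∀ᶠ x in 𝓝 e, |x - e| < ε ∧ ∀ y ∈ unitI, |y - e| ≤ |x - e| →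
          |derivWithin X unitI y| ≤ ε := by
      intro e he hde
      obtain ⟨δ, hδ, hδ'⟩ := Metric.continuousWithinAt_iff.1 (hcont e he) ε hε
      filter_upwards [Metric.ball_mem_nhds e hδ, Metric.ball_mem_nhds e hε] with x hx hx'
      refine ⟨hx', fun y hy hyx => ?_⟩
      have h2 := hδ' hy (lt_of_le_of_lt hyx hx)
      rw [hde, dist_zero_right] at h2
      exact h2.le
    have hN0 := (hf.tendsto_iterate h half_mem_Ioo).eventually (hnear 0 zero_mem_unitI h0)
    have hN1 := (hg.tendsto_iterate (hg.movesTo_symm hi h) half_mem_Ioo).eventually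
      (hnear 1 one_mem_unitI h1)
    obtain ⟨N, ⟨hu, hu'⟩, hv, hv'⟩ := (hN0.and hN1).exists
    rw [← F.flow_nat hJ haI] at hu hu'
    rw [← F.flow_neg_nat hJ hi haI] at hv hv'
    change |ψ N - 0| < ε at hu
    change |ψ (-N) - 1| < ε at hv
    have hNpos : (0 : ℝ) ≤ N := N.cast_nonneg
    have hHtop : ∀ t, (N : ℝ) ≤ t → |derivWithin X unitI (ψ t)| ≤ ε := fun t ht => by
      refine hu' _ (Ioo_subset_unitI (hψmem t)) ?_
      rw [sub_zero, sub_zero, abs_of_pos (hψmem t).1, abs_of_pos (hψmem N).1]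
      exact hanti.antitone ht
    have hHbot : ∀ t, t ≤ -(N : ℝ) → |derivWithin X unitI (ψ t)| ≤ ε := fun t ht => by
      refine hv' _ (Ioo_subset_unitI (hψmem t)) ?_
      rw [abs_sub_comm, abs_sub_comm _ (1 : ℝ), abs_of_pos (sub_pos.2 (hψmem t).2),
        abs_of_pos (sub_pos.2 (hψmem _).2)]
      exact sub_le_sub_left (hanti.antitone ht) 1
    rw [sub_zero, abs_of_pos (hψmem N).1] at hu
    rw [abs_sub_comm, abs_of_pos (sub_pos.2 (hψmem _).2)] at hv
    have hvar : ∀ n : ℕ, varLogDeriv (f^[n]) ≤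
        ENNReal.ofReal (n * ((2 * C + 2) * ε) + 4 * N * B) := by
      intro n
      have hnpos : (0 : ℝ) ≤ n := n.cast_nonneg
      have hCε : 0 ≤ C * ε := mul_nonneg C.2 hε.le
      set u := ψ N
      set v := ψ (-N - n)
      have huv : u ≤ v := hanti.antitone (by linarith)
      have hV1 : eVariationOn (birkhoffSum f (logD f) n) (Icc 0 u) ≤
          ENNReal.ofReal (n * (C * ε)) := by
        refine (hf.eVariationOn_birkhoffSum_le hC n le_rfl (hψmem N).1.le (hψmem N).2.le).trans ?_
        rw [← ENNReal.ofReal_sum_of_nonneg]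
        · refine ENNReal.ofReal_le_ofReal
            ((Finset.sum_le_card_nsmul _ _ (C * ε) fun k _ => ?_).trans (by simp))
          refine mul_le_mul_of_nonneg_left ?_ C.2
          rw [hf.iterate_zero, sub_zero, F.iterate_flow hJ haI]
          exact (hanti.antitone (by linarith [(k.cast_nonneg : (0 : ℝ) ≤ k)])).trans hu.le
        · intro k _
          rw [hf.iterate_zero, sub_zero]
          exact mul_nonneg C.2 (hf.iterate_mem_Ioo (hψmem N) k).1.le
      have hV3 : eVariationOn (birkhoffSum f (logD f) n) (Icc v 1) ≤
          ENNReal.ofReal (n * (C * ε)) := by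
        refine (hf.eVariationOn_birkhoffSum_le hC n (hψmem _).1.le (hψmem _).2.le le_rfl).trans ?_
        rw [← ENNReal.ofReal_sum_of_nonneg]
        · refine ENNReal.ofReal_le_ofReal
            ((Finset.sum_le_card_nsmul _ _ (C * ε) fun k hk => ?_).trans (by simp))
          refine mul_le_mul_of_nonneg_left ?_ C.2
          have hk' : (k : ℝ) ≤ n := by exact_mod_cast (Finset.mem_range.1 hk).le
          rw [hf.iterate_one, F.iterate_flow hJ haI]
          refine le_trans (sub_le_sub_left ?_ 1) hv.le
          exact hanti.antitone (by linarith)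
        · intro k _
          rw [hf.iterate_one]
          exact mul_nonneg C.2 (sub_nonneg.2 (hf.iterate_mem_Ioo (hψmem _) k).2.le)
      have hwN : eVariationOn w (Icc (-N) N) ≤ ENNReal.ofReal (2 * N * B) := by
        refine (eVariationOn_Icc_le_of_hasDerivAt hw hB0 fun t _ =>
          hB _ (Ioo_subset_unitI (hψmem t))).trans (ENNReal.ofReal_le_ofReal ?_)
        linarith
      have hw1 : eVariationOn w (Icc (-N) (N + n)) ≤ ENNReal.ofReal (2 * N * B + n * ε) := by
        rw [← eVariationOn_Icc_add_Icc w (by linarith : -(N : ℝ) ≤ N)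
          (by linarith : (N : ℝ) ≤ N + n), ENNReal.ofReal_add (by positivity) (by positivity)]
        refine add_le_add hwN ((eVariationOn_Icc_le_of_hasDerivAt hw hε.le fun t ht =>
          hHtop t ht.1).trans (ENNReal.ofReal_le_ofReal ?_))
        linarith
      have hw2 : eVariationOn w (Icc (-N - n) N) ≤ ENNReal.ofReal (2 * N * B + n * ε) := by
        rw [← eVariationOn_Icc_add_Icc w (by linarith : -(N : ℝ) - n ≤ -N)
          (by linarith : -(N : ℝ) ≤ N), add_comm,
          ENNReal.ofReal_add (by positivity) (by positivity)]
        refine add_le_add hwN ((eVariationOn_Icc_le_of_hasDerivAt hw hε.le fun t ht =>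
          hHbot t ht.2).trans (ENNReal.ofReal_le_ofReal ?_))
        linarith
      have hV2 : eVariationOn (birkhoffSum f (logD f) n) (Icc u v) ≤
          ENNReal.ofReal (2 * N * B + n * ε) + ENNReal.ofReal (2 * N * B + n * ε) := by
        have hsub : Icc u v ⊆ ψ '' Icc (-N - n) N := by
          intro x hx
          obtain ⟨t, rfl⟩ := F.exists_flow_eq hJ hf half_mem_Ioo
            (⟨(hψmem N).1.trans_le hx.1, hx.2.trans_lt (hψmem _).2⟩ : x ∈ Ioo (0 : ℝ) 1)
          exact ⟨t, ⟨hanti.le_iff_ge.1 hx.2, hanti.le_iff_ge.1 hx.1⟩, rfl⟩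
        refine (eVariationOn.mono _ hsub).trans ?_
        rw [← eVariationOn.comp_eq_of_antitoneOn _ _ (hanti.antitone.antitoneOn _)]
        have heq : birkhoffSum f (logD f) n ∘ ψ = fun t => w (t + n) + -w t := funext fun t => by
          rw [Function.comp_apply, F.log_iterate hf (hψmem t), F.iterate_flow hJ haI, sub_eq_add_neg]
        rw [heq]
        refine (eVariationOn_add_le _ _ _).trans (add_le_add (le_trans ?_ hw1) ?_)
        · refine eVariationOn.comp_le_of_monotoneOn w (fun t => t + (n : ℝ))
            (fun s _ t _ hst => by simpa using hst) fun t ht => ⟨?_, ?_⟩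
          · linarith [ht.1]
          · linarith [ht.2]
        · rw [eVariationOn_neg]
          exact hw2
      rw [hf.varLogDeriv_iterate, ← eVariationOn_Icc_add_Icc _ (hψmem N).1.le (hψmem N).2.le,
        ← eVariationOn_Icc_add_Icc _ huv (hψmem _).2.le]
      refine (add_le_add hV1 (add_le_add hV2 hV3)).trans ?_
      rw [← ENNReal.ofReal_add (by positivity) (by positivity),
        ← ENNReal.ofReal_add (by positivity) (by positivity),
        ← ENNReal.ofReal_add (by positivity) (by positivity)]
      refine ENNReal.ofReal_le_ofReal (le_of_eq ?_)
      ring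
    have hlim : Tendsto (fun n : ℕ => ENNReal.ofReal ((2 * C + 2) * ε + 4 * N * B / n)) atTop
        (𝓝 (ENNReal.ofReal ((2 * C + 2) * ε))) := by
      refine (ENNReal.continuous_ofReal.tendsto _).comp ?_
      simpa using (tendsto_const_div_atTop_nhds_zero_nat (4 * N * B)).const_add ((2 * C + 2) * ε)
    refine le_of_tendsto_of_tendsto hf.tendsto_asymptoticDistortion hlim ?_
    filter_upwards [eventually_gt_atTop 0] with n hn
    have hn' : (0 : ℝ) < n := by exact_mod_cast hn
    refine (ENNReal.div_le_div_right (hvar n) _).trans (le_of_eq ?_)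
    rw [← ENNReal.ofReal_natCast, ← ENNReal.ofReal_div_of_pos hn']
    congr 1
    field_simp
  have hlim : Tendsto (fun ε : ℝ => ENNReal.ofReal ((2 * C + 2) * ε)) (𝓝[>] 0) (𝓝 0) := by
    have : Continuous fun ε : ℝ => ENNReal.ofReal ((2 * C + 2) * ε) :=
      ENNReal.continuous_ofReal.comp (by fun_prop)
    simpa using (this.tendsto 0).mono_left nhdsWithin_le_nhds
  refine le_antisymm (ge_of_tendsto hlim ?_) bot_le
  filter_upwards [self_mem_nhdsWithin] with ε hε using main ε hε

namespace IsDiffTwoDelta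

variable {f : ℝ → ℝ}

theorem asymptoticDistortion_eq_zero_iff_isTimeOneOfFlatField (hf : IsDiffTwoDelta f) :
    asymptoticDistortion f = 0 ↔ IsTimeOneOfFlatField f := by
  have key : ∀ {f : ℝ → ℝ}, IsDiffTwoDelta f → MovesTo f 0 →
      (asymptoticDistortion f = 0 ↔ IsTimeOneOfFlatField f) := fun hf h =>
    ⟨hf.isTimeOneOfFlatField_of_movesTo h, fun ⟨_, _, F, ⟨_, h0⟩, _, h1⟩ =>
      F.asymptoticDistortion_eq_zero hf h h0 h1⟩
  rcases hf.exists_movesTo with h | h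
  · exact key hf h
  · obtain ⟨g, hg, hi⟩ := hf.exists_symm
    rw [← hf.asymptoticDistortion_symm hg hi, key hg (hg.movesTo_symm' hi h)]
    exact ⟨fun h => h.symm hi, fun h => h.symm hi.symm⟩

/-- If a Mather map is a rotation, then the left and the right generating fields coincide in `(0,1)`
and glue to a `C¹` field on `[0,1]`. -/
theorem isTimeOneOfFlatField_of_trivialMatherInvariant (hf : IsDiffTwoDelta f)
    (hp : ParabolicEndpoints f) (hm : TrivialMatherInvariant f) : IsTimeOneOfFlatField f := by
  have hid : (fun t : ℝ => t + 0) ∈ matherInvariant f := by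
    rw [hm]
    exact ⟨0, rfl⟩
  obtain ⟨a, ha, b, hb, M, ⟨X, Y, φ, χ, ⟨F, -⟩, ⟨G, -⟩, hM⟩, c, d, hN⟩ := hid
  have hI := isUnitInterval_Ico
  have hI' := isUnitInterval_Ioc
  have hM' : ∀ t, M t = t - c - d := fun t => by
    have := congrFun hN (t - c)
    simp only [sub_add_cancel] at this
    linarith
  have hXY : EqOn X Y (Ioo 0 1) := fun x hx => by
    obtain ⟨t, rfl⟩ := F.exists_flow_eq hI hf ha hx
    have h1 := F.isFlowOn.hasDerivAt a (hI.Ioo_subset ha) t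
    have h2 := (G.isFlowOn.hasDerivAt b (hI'.Ioo_subset hb) (t - (c + d))).comp_sub_const t (c + d)
    have h3 : (fun s => χ (s - (c + d)) b) = fun s => φ s a := funext fun s => by
      rw [← hM, hM', sub_sub]
    rw [h3, ← sub_sub, ← hM', hM] at h2
    exact h1.unique h2
  set Z : ℝ → ℝ := fun x => if x < 1 then X x else Y x
  have hZX : EqOn Z X (Ico 0 1) := fun x hx => if_pos hx.2
  have hZY : EqOn Z Y (Ioc 0 1) := fun x hx => by
    rcases eq_or_lt_of_le hx.2 with rfl | h1
    · exact if_neg (lt_irrefl _)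
    · rw [hZX ⟨hx.1.le, h1⟩, hXY ⟨hx.1, h1⟩]
  have hloc0 : ∀ x ∈ Ico (0 : ℝ) 1, 𝓝[unitI] x = 𝓝[Ico 0 1] x := fun x hx => by
    rw [show Ico (0 : ℝ) 1 = unitI ∩ Iio 1 by ext y; simp +contextual [le_of_lt]]
    exact (nhdsWithin_inter_of_mem' (mem_nhdsWithin_of_mem_nhds (Iio_mem_nhds hx.2))).symm
  have hloc1 : ∀ x ∈ Ioc (0 : ℝ) 1, 𝓝[unitI] x = 𝓝[Ioc 0 1] x := fun x hx => by
    rw [show Ioc (0 : ℝ) 1 = unitI ∩ Ioi 0 by ext y; simp +contextual [le_of_lt, and_comm]]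
    exact (nhdsWithin_inter_of_mem' (mem_nhdsWithin_of_mem_nhds (Ioi_mem_nhds hx.1))).symm
  have hC : ContDiffOn ℝ 1 Z unitI := fun x hx => by
    rcases eq_or_lt_of_le hx.2 with rfl | h1
    · exact ((G.contDiffOn.congr hZY) 1 (by simp)).mono_of_mem_nhdsWithin
        (hloc1 1 (by simp) ▸ self_mem_nhdsWithin)
    · exact ((F.contDiffOn.congr hZX) x ⟨hx.1, h1⟩).mono_of_mem_nhdsWithin
        (hloc0 x ⟨hx.1, h1⟩ ▸ self_mem_nhdsWithin)
  have hZ1 : Z 1 = 0 := by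
    rw [hZY (by simp)]
    exact G.apply_endpoint hI' (by simp) (Or.inr rfl)
  have hZ0 : Z 0 = 0 := by
    rw [hZX (by simp)]
    exact F.apply_endpoint hI (by simp) (Or.inl rfl)
  have E : Generates unitI Z (fun t x => if x < 1 then φ t x else 1) f := by
    refine ⟨hC, ⟨fun t x hx => ?_, fun x hx => ?_, fun x hx t => ?_⟩, fun x hx => ?_⟩ <;>
      rcases eq_or_lt_of_le hx.2 with rfl | h1
    · simp
    · simp only [h1, if_true]
      exact Ico_subset_Icc_self (F.mem ⟨hx.1, h1⟩ t)
    · simp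
    · simp only [h1, if_true]
      exact F.isFlowOn.zero x ⟨hx.1, h1⟩
    · simp only [lt_irrefl, if_false, hZ1]
      exact hasDerivAt_const t _
    · simp only [h1, if_true]
      rw [hZX (F.mem ⟨hx.1, h1⟩ t)]
      exact F.isFlowOn.hasDerivAt x ⟨hx.1, h1⟩ t
    · simp [hf.map_one]
    · simp only [h1, if_true]
      exact F.time_one x ⟨hx.1, h1⟩
  refine ⟨Z, _, E, ⟨hZ0, ?_⟩, hZ1, ?_⟩
  · rw [← E.logD_endpoint isUnitInterval_unitI hf zero_mem_unitI (Or.inl rfl), logD, hp.1,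
      Real.log_one]
  · rw [← E.logD_endpoint isUnitInterval_unitI hf one_mem_unitI (Or.inr rfl), logD, hp.2,
      Real.log_one]

theorem isTimeOneOfFlatField_iff (hf : IsDiffTwoDelta f) :
    IsTimeOneOfFlatField f ↔ ParabolicEndpoints f ∧ TrivialMatherInvariant f :=
  ⟨fun ⟨_, _, F, ⟨_, h0⟩, _, h1⟩ => ⟨F.parabolicEndpoints hf h0 h1,
    F.trivialMatherInvariant hf h0 h1⟩,
    fun h => hf.isTimeOneOfFlatField_of_trivialMatherInvariant h.1 h.2⟩

end IsDiffTwoDelta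

theorem theoremA (f : ℝ → ℝ) (hf : IsDiffTwoDelta f) :
    (Tendsto (distortionSeq f) atTop (𝓝 (asymptoticDistortion f)) ∧
      asymptoticDistortion f ≠ ⊤) ∧
    (asymptoticDistortion f = 0 ↔ ParabolicEndpoints f ∧ TrivialMatherInvariant f) ∧
    (asymptoticDistortion f = 0 ↔ IsTimeOneOfFlatField f) := by
  have h := hf.asymptoticDistortion_eq_zero_iff_isTimeOneOfFlatField
  exact ⟨⟨hf.tendsto_asymptoticDistortion, hf.asymptoticDistortion_ne_top⟩,
    h.trans hf.isTimeOneOfFlatField_iff, h⟩
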